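/- Let $\mathfrak m\ge 0$ and let $(\hat M,\hat g)$ be the (static exterior) Schwarzschild spacetime of mass $\mathfrak m$, i.e. $\hat M=\mathbb R\times(2\mathfrak m,\infty)\times S^2$ with $$\hat g=-\phi^2dt^2+\phi^{-2}dr^2+r^2g_{S^2},\qquad \phi^2=1-\frac{2\mathfrak m}{r},$$ time-oriented by $\partial_t$. Let $r^*=r+2\mathfrak m\log\left(\frac{r}{2\mathfrak m}-1\right)$ be the tortoise coordinate ($r^*=r$ if $\mathfrak m=0$), and put $u=r^*+t$, $v=r^*-t$. Let $(M^3,g,k)$ be any (not necessarily spherically symmetric) smooth initial data set in $(\hat M,\hat g)$: $M$ is a smooth spacelike hypersurface with induced Riemannian metric $g$, future pointing unit normal $N$, and second fundamental form $k(X,Y)=\hat g(\hat\nabla_XY,N)=-\hat g(\hat\nabla_XN,Y)$. Denote the restrictions of $u,v$ to $M$ again by $u,v$; let $\nabla$, $|\cdot|$, $\langle\cdot,\cdot\rangle$ be taken with respect to $g$. For a function $f$ on $M$ with $\nabla f\neq0$ let $\Sigma_f$ be its level sets, with unit normal $\nu_f=\nabla f/|\nabla f|$, mean curvature $H=\operatorname{tr}_{\Sigma_f}(\nabla\nu_f)$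 and null expansions $\theta_\pm(\Sigma_f)=H\pm\operatorname{tr}_{\Sigma_f}k$. Then, everywhere on $M$, $\nabla u\ne0$, $\nabla v\neq0$, $$\theta_+(\Sigma_u)|\nabla u|=\phi^2\,\frac{|\nabla u||\nabla v|+\langle\nabla u,\nabla v\rangle}{r},\qquad \theta_-(\Sigma_v)|\nabla v|=\phi^2\,\frac{|\nabla u||\nabla v|+\langle\nabla u,\nabla v\rangle}{r},$$ and $$\nabla^2u=-k|\nabla u|+\frac{g}{2r}\phi^2\bigl(|\nabla u||\nabla v|+\langle\nabla u,\nabla v\rangle\bigr)-\frac{\mathfrak m}{r^2}\nabla u\otimes\nabla u-\frac{\phi^2}{2r}\bigl(\nabla u\otimes\nabla v+\nabla v\otimes\nabla u\bigr),$$ $$\nabla^2v=+k|\nabla v|+\frac{g}{2r}\phi^2\bigl(|\nabla u||\nabla v|+\langle\nabla u,\nabla v\rangle\bigr)-\frac{\mathfrak m}{r^2}\nabla v\otimes\nabla v-\frac{\phi^2}{2r}\bigl(\nabla u\otimes\nabla v+\nabla v\otimes\nabla u\bigr).$$ -/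

import Mathlib

open scoped Manifold ContDiff

noncomputable section

/-! ### Riemannian and Lorentzian geometry in local coordinates

A (pseudo-)metric on an open set of `ℝⁿ` is given by its matrix of components `G x i j = g(∂ᵢ, ∂ⱼ)`,
vectors and vector fields by their components `X i`. -/

/-- Coordinate space `ℝⁿ`. -/
abbrev CoordSpace (n : ℕ) : Type := EuclideanSpace ℝ (Fin n)

/-- The partial derivative `∂ᵢ f`. -/
def pd {n : ℕ} (i : Fin n) (f : CoordSpace n → ℝ) (x : CoordSpace n) : ℝ :=
  fderiv ℝ f x (EuclideanSpace.single i 1)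

/-- The value of a bilinear form with matrix `A` on two vectors, `∑ᵢⱼ Aᵢⱼ Xⁱ Yʲ`. -/
def bilin {n : ℕ} (A : Matrix (Fin n) (Fin n) ℝ) (X Y : Fin n → ℝ) : ℝ :=
  ∑ i, ∑ j, A i j * X i * Y j

/-- The Christoffel symbols `Γˡᵢⱼ = ½ gˡˢ (∂ᵢ gⱼₛ + ∂ⱼ gᵢₛ - ∂ₛ gᵢⱼ)` of the Levi-Civita
connection. -/
def christoffel {n : ℕ} (G : CoordSpace n → Matrix (Fin n) (Fin n) ℝ) (x : CoordSpace n)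
    (l i j : Fin n) : ℝ :=
  ∑ s, (G x)⁻¹ l s *
    ((pd i (fun y => G y j s) x + pd j (fun y => G y i s) x - pd s (fun y => G y i j) x) / 2)

/-- The gradient `(∇f)ⁱ = gⁱʲ ∂ⱼ f`. -/
def gradVec {n : ℕ} (G : CoordSpace n → Matrix (Fin n) (Fin n) ℝ) (f : CoordSpace n → ℝ)
    (x : CoordSpace n) (i : Fin n) : ℝ :=
  ∑ j, (G x)⁻¹ i j * pd j f x

/-- The length `|∇f|` of the gradient for a Riemannian metric. -/
def gradNorm {n : ℕ} (G : CoordSpace n → Matrix (Fin n) (Fin n) ℝ) (f : CoordSpace n → ℝ)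
    (x : CoordSpace n) : ℝ :=
  Real.sqrt (bilin (G x) (gradVec G f x) (gradVec G f x))

/-- The inner product `⟨∇f, ∇h⟩` of two gradients. -/
def gradInner {n : ℕ} (G : CoordSpace n → Matrix (Fin n) (Fin n) ℝ) (f h : CoordSpace n → ℝ)
    (x : CoordSpace n) : ℝ :=
  bilin (G x) (gradVec G f x) (gradVec G h x)

/-- The Hessian `∇²ᵢⱼ f = ∂ᵢ∂ⱼ f - Γˡᵢⱼ ∂ₗ f`. -/
def hessian {n : ℕ} (G : CoordSpace n → Matrix (Fin n) (Fin n) ℝ) (f : CoordSpace n → ℝ)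
    (x : CoordSpace n) (i j : Fin n) : ℝ :=
  pd i (fun y => pd j f y) x - ∑ l, christoffel G x l i j * pd l f x

/-- The covariant derivative `(∇ᵢ X)ˡ = ∂ᵢ Xˡ + Γˡᵢⱼ Xʲ` of a vector field. -/
def covDeriv {n : ℕ} (G : CoordSpace n → Matrix (Fin n) (Fin n) ℝ)
    (X : CoordSpace n → Fin n → ℝ) (x : CoordSpace n) (i l : Fin n) : ℝ :=
  pd i (fun y => X y l) x + ∑ j, christoffel G x l i j * X x j

/-- The unit normal `ν_f = ∇f / |∇f|` of the level sets of `f`. -/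
def levelNormal {n : ℕ} (G : CoordSpace n → Matrix (Fin n) (Fin n) ℝ) (f : CoordSpace n → ℝ)
    (x : CoordSpace n) (i : Fin n) : ℝ :=
  gradVec G f x i / gradNorm G f x

/-- The trace `tr_Σ A = (gⁱʲ - νⁱνʲ) Aᵢⱼ` of a 2-tensor over the tangent space at `x` of the
level set `Σ` of `f` through `x`. -/
def levelTrace {n : ℕ} (G : CoordSpace n → Matrix (Fin n) (Fin n) ℝ) (f : CoordSpace n → ℝ)
    (x : CoordSpace n) (A : Fin n → Fin n → ℝ) : ℝ :=
  ∑ i, ∑ j, ((G x)⁻¹ i j - levelNormal G f x i * levelNormal G f x j) * A i j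

/-- The mean curvature `H`, with respect to `ν_f`, of the level set of `f` through `x`: the trace
over its tangent space of its second fundamental form `(X, Y) ↦ ⟨∇_X ν_f, Y⟩`. -/
def levelMeanCurvature {n : ℕ} (G : CoordSpace n → Matrix (Fin n) (Fin n) ℝ)
    (f : CoordSpace n → ℝ) (x : CoordSpace n) : ℝ :=
  levelTrace G f x fun i j => ∑ l, G x j l * covDeriv G (levelNormal G f) x i l

/-- The null expansion `θ₊ = H + tr_Σ k` of the level set of `f` through `x`. -/
def thetaPlus {n : ℕ} (G : CoordSpace n → Matrix (Fin n) (Fin n) ℝ)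
    (k : CoordSpace n → Fin n → Fin n → ℝ) (f : CoordSpace n → ℝ) (x : CoordSpace n) : ℝ :=
  levelMeanCurvature G f x + levelTrace G f x (k x)

/-- The null expansion `θ₋ = H - tr_Σ k` of the level set of `f` through `x`. -/
def thetaMinus {n : ℕ} (G : CoordSpace n → Matrix (Fin n) (Fin n) ℝ)
    (k : CoordSpace n → Fin n → Fin n → ℝ) (f : CoordSpace n → ℝ) (x : CoordSpace n) : ℝ :=
  levelMeanCurvature G f x - levelTrace G f x (k x)

namespace Schwarzschild

/-! ### The Schwarzschild spacetime

The static exterior `ℝ × (2m, ∞) × S²` is identified with the set of all `y = (t, x) ∈ ℝ × ℝ³` with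
`|x| > 2m` through `(t, r, ω) ↦ (t, r ω)`, so that one global chart suffices. -/

/-- The static time `t`. -/
def time (y : CoordSpace 4) : ℝ := y 0

/-- The area radius `r = |x|`. -/
def radius (y : CoordSpace 4) : ℝ := Real.sqrt (y 1 ^ 2 + y 2 ^ 2 + y 3 ^ 2)

/-- `φ² = 1 - 2m/r`. -/
def phiSq (m : ℝ) (y : CoordSpace 4) : ℝ := 1 - 2 * m / radius y

/-- The components of `dt`. -/
def dt (a : Fin 4) : ℝ := if a = 0 then 1 else 0

/-- The components of `dr = (x₁ dx₁ + x₂ dx₂ + x₃ dx₃) / r`. -/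
def dr (y : CoordSpace 4) (a : Fin 4) : ℝ := if a = 0 then 0 else y a / radius y

/-- The components of the round metric of the unit sphere, pulled back along `(t, x) ↦ x / |x|`:
the Euclidean metric of `ℝ³` is `dr² + r² g_{S²}`, hence
`g_{S²} = r⁻² (dx₁² + dx₂² + dx₃² - dr²)`. -/
def sphereMetric (y : CoordSpace 4) (a b : Fin 4) : ℝ :=
  ((if a = b ∧ a ≠ 0 then 1 else 0) - dr y a * dr y b) / radius y ^ 2

/-- The Schwarzschild metric `-φ² dt² + φ⁻² dr² + r² g_{S²}` of mass `m`. -/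
def metric (m : ℝ) (y : CoordSpace 4) : Matrix (Fin 4) (Fin 4) ℝ := fun a b =>
  -phiSq m y * (dt a * dt b) + (phiSq m y)⁻¹ * (dr y a * dr y b)
    + radius y ^ 2 * sphereMetric y a b

/-- The tortoise coordinate `r* = r + 2m log (r / (2m) - 1)`; for `m = 0` this is `r* = r`. -/
def tortoise (m : ℝ) (y : CoordSpace 4) : ℝ :=
  radius y + 2 * m * Real.log (radius y / (2 * m) - 1)

/-- The null function `u = r* + t`. -/
def nullU (m : ℝ) (y : CoordSpace 4) : ℝ := tortoise m y + time y

/-- The null function `v = r* - t`. -/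
def nullV (m : ℝ) (y : CoordSpace 4) : ℝ := tortoise m y - time y

/-- The image in `ℝ⁴` of a tangent vector `X` at `p` under the differential of a map `F`. -/
def push {M : Type*} [TopologicalSpace M] [ChartedSpace (CoordSpace 3) M] (F : M → CoordSpace 4)
    (p : M) (X : TangentSpace (𝓡 3) p) : CoordSpace 4 :=
  mfderiv (𝓡 3) 𝓘(ℝ, CoordSpace 4) F p X

/-- A spacelike slice of the Schwarzschild exterior of mass `m`: a smooth spacelike immersion
(in particular, an embedding or an inclusion) of a 3-manifold `M`, together with its future
pointing timelike unit normal, which the immersion determines. -/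
structure Slice (m : ℝ) (M : Type*) [TopologicalSpace M] [ChartedSpace (CoordSpace 3) M] where
  /-- the immersion -/
  toFun : M → CoordSpace 4
  /-- the future pointing unit normal `N` -/
  normal : M → CoordSpace 4
  smooth : ContMDiff (𝓡 3) 𝓘(ℝ, CoordSpace 4) ∞ toFun
  exterior : ∀ p, 2 * m < radius (toFun p)
  spacelike : ∀ (p : M) (X : TangentSpace (𝓡 3) p), X ≠ 0 →
    0 < bilin (metric m (toFun p)) (push toFun p X) (push toFun p X)
  normal_orthogonal : ∀ (p : M) (X : TangentSpace (𝓡 3) p),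
    bilin (metric m (toFun p)) (normal p) (push toFun p X) = 0
  normal_unit : ∀ p, bilin (metric m (toFun p)) (normal p) (normal p) = -1
  normal_future : ∀ p, 0 < normal p 0

namespace Slice

variable {m : ℝ} {M : Type*} [TopologicalSpace M] [ChartedSpace (CoordSpace 3) M]

/-- The immersion in the coordinates of the chart `e` of `M`. -/
def param (S : Slice m M) (e : OpenPartialHomeomorph M (CoordSpace 3)) (x : CoordSpace 3) :
    CoordSpace 4 := S.toFun (e.symm x)

/-- The coordinate vector `∂ᵢ` of the chart `e` of `M` as a vector of the spacetime. -/
def tangent (S : Slice m M) (e : OpenPartialHomeomorph M (CoordSpace 3)) (x : CoordSpace 3)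
    (i : Fin 3) (a : Fin 4) : ℝ := pd i (fun z => S.param e z a) x

/-- The components in the chart `e` of the induced metric `g`. -/
def inducedMetric (S : Slice m M) (e : OpenPartialHomeomorph M (CoordSpace 3))
    (x : CoordSpace 3) : Matrix (Fin 3) (Fin 3) ℝ := fun i j =>
  bilin (metric m (S.param e x)) (S.tangent e x i) (S.tangent e x j)

/-- The spacetime covariant derivative of the vector field `∂ⱼ` along `∂ᵢ`. -/
def ambientDeriv (S : Slice m M) (e : OpenPartialHomeomorph M (CoordSpace 3))
    (x : CoordSpace 3) (i j : Fin 3) (a : Fin 4) : ℝ :=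
  pd i (fun z => S.tangent e z j a) x
    + ∑ c, ∑ d, christoffel (metric m) (S.param e x) a c d * S.tangent e x i c * S.tangent e x j d

/-- The components in the chart `e` of the second fundamental form `k`. The sign convention is
`k(X, Y) = ĝ(∇̂_X Y, N) = -ĝ(∇̂_X N, Y)` with `N` the future pointing unit normal; equivalently,
`∇̂² f = ∇² f + N(f) k` on vectors tangent to the slice. -/
def secondForm (S : Slice m M) (e : OpenPartialHomeomorph M (CoordSpace 3))
    (x : CoordSpace 3) (i j : Fin 3) : ℝ :=
  bilin (metric m (S.param e x)) (S.ambientDeriv e x i j) (S.normal (e.symm x))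

/-- The restriction of `u = r* + t` to the slice, in the chart `e`. -/
def u (S : Slice m M) (e : OpenPartialHomeomorph M (CoordSpace 3)) (x : CoordSpace 3) : ℝ :=
  nullU m (S.param e x)

/-- The restriction of `v = r* - t` to the slice, in the chart `e`. -/
def v (S : Slice m M) (e : OpenPartialHomeomorph M (CoordSpace 3)) (x : CoordSpace 3) : ℝ :=
  nullV m (S.param e x)

end Slice

end Schwarzschild

end

/-! Write `f = r* + σt` with `σ = ±1` and let `N` be the future unit normal. The argument needs
three facts about `f` in the spacetime.

(1) The spacetime Hessian of `f` is `ĝ/r - (m/r²) df⊗df - (φ²/2r)(du⊗dv + dv⊗du)`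
(`hessian_nullFun`). This is a direct computation in Cartesian coordinates, where every tensor is
built from `dt`, `dr` and the flat spatial metric.

(2) The spacetime gradients of `u` and `v` are null, with mutual product `2/φ²`
(`sum_nullGrad_mul_pd`).

(3) `N(u) > 0 > N(v)`, because `|dr*(N)| < dt(N)` for a future timelike vector
(`sum_pd_nullFun_sign`).

Two general facts bring these down to the slice. By the Gauss formula, the intrinsic Hessian is the
restricted spacetime Hessian minus `N(f) k` (`hessian_pullbackMetric`). Splitting a gradient into
tangential and normal parts gives `⟨∇f, ∇h⟩ = ĝ(∇̂f, ∇̂h) + N(f) N(h)` (`gradInner_pullbackMetric`).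
By nullity and the signs, `|∇u| = N(u)` and `|∇v| = -N(v)`, so both gradients are nonzero. Moreover
`⟨∇u, ∇v⟩ = 2/φ² - |∇u||∇v|`, that is, `φ²(|∇u||∇v| + ⟨∇u, ∇v⟩) = 2`. Hence the term `g/r` inherited
from (1) is the `g`-term of the claimed Hessian formulas.

For the expansions, `H|∇f|` is the trace of `∇²f` over the level set
(`levelMeanCurvature_mul_gradNorm`). Terms with a factor `df` have no trace there, `g` has trace 2,
and the `k`-term cancels against the one in `θ±`. What remains is `2/r` in both cases. -/

noncomputable section

/-! ### Calculus of partial derivatives -/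

section PartialDerivatives

variable {n N : ℕ}

theorem pd_congr {f h : CoordSpace n → ℝ} {x : CoordSpace n} (H : f =ᶠ[nhds x] h) (i : Fin n) :
    pd i f x = pd i h x := by
  simp only [pd, H.fderiv_eq]

theorem pd_const (c : ℝ) (x : CoordSpace n) (i : Fin n) : pd i (fun _ => c) x = 0 := by
  simp [pd]

theorem pd_add {f h : CoordSpace n → ℝ} {x : CoordSpace n} (hf : DifferentiableAt ℝ f x)
    (hh : DifferentiableAt ℝ h x) (i : Fin n) :
    pd i (fun y => f y + h y) x = pd i f x + pd i h x := by
  simp [pd, fderiv_fun_add hf hh]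

theorem pd_mul {f h : CoordSpace n → ℝ} {x : CoordSpace n} (hf : DifferentiableAt ℝ f x)
    (hh : DifferentiableAt ℝ h x) (i : Fin n) :
    pd i (fun y => f y * h y) x = pd i f x * h x + f x * pd i h x := by
  simp [pd, fderiv_fun_mul hf hh]; ring

theorem pd_sum {ι : Type*} {s : Finset ι} {f : ι → CoordSpace n → ℝ} {x : CoordSpace n}
    (hf : ∀ a ∈ s, DifferentiableAt ℝ (f a) x) (i : Fin n) :
    pd i (fun y => ∑ a ∈ s, f a y) x = ∑ a ∈ s, pd i (f a) x := by
  simp [pd, fderiv_fun_sum hf]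

theorem pd_comp_real {φ : ℝ → ℝ} {φ' : ℝ} {f : CoordSpace n → ℝ} {x : CoordSpace n}
    (hφ : HasDerivAt φ φ' (f x)) (hf : DifferentiableAt ℝ f x) (i : Fin n) :
    pd i (fun y => φ (f y)) x = φ' * pd i f x := by
  have := (hφ.comp_hasFDerivAt x hf.hasFDerivAt).fderiv
  simp only [pd]
  change (fderiv ℝ (φ ∘ f) x) _ = _
  simp [this]

theorem pd_coord (a i : Fin n) (x : CoordSpace n) :
    pd i (fun y => y a) x = if i = a then 1 else 0 := by
  have : fderiv ℝ (fun y : CoordSpace n => y a) x = EuclideanSpace.proj a :=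
    (EuclideanSpace.proj (𝕜 := ℝ) a).fderiv
  simp [pd, this, eq_comm]

theorem fderiv_coord {F : CoordSpace n → CoordSpace N} {x : CoordSpace n}
    (hF : DifferentiableAt ℝ F x) (X : CoordSpace n) (a : Fin N) :
    fderiv ℝ (fun z => F z a) x X = (fderiv ℝ F x X) a := by
  have := ((EuclideanSpace.proj a : CoordSpace N →L[ℝ] ℝ).hasFDerivAt.comp x
    hF.hasFDerivAt).fderiv
  change fderiv ℝ ((EuclideanSpace.proj a : CoordSpace N →L[ℝ] ℝ) ∘ F) x X = _
  rw [this]; rfl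

theorem fderiv_eq_sum_pd (f : CoordSpace n → ℝ) (x X : CoordSpace n) :
    fderiv ℝ f x X = ∑ i, X i * pd i f x := by
  conv_lhs => rw [← (EuclideanSpace.basisFun (Fin n) ℝ).sum_repr X]
  simp [pd]

theorem pd_comp {F : CoordSpace n → CoordSpace N} {f : CoordSpace N → ℝ} {x : CoordSpace n}
    (hf : DifferentiableAt ℝ f (F x)) (hF : DifferentiableAt ℝ F x) (i : Fin n) :
    pd i (fun z => f (F z)) x = ∑ a, pd a f (F x) * pd i (fun z => F z a) x := by
  have h : fderiv ℝ (fun z => f (F z)) x = (fderiv ℝ f (F x)).comp (fderiv ℝ F x) :=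
    fderiv_comp x hf hF
  rw [pd, h, ContinuousLinearMap.comp_apply, fderiv_eq_sum_pd]
  refine Finset.sum_congr rfl fun a _ => ?_
  rw [← fderiv_coord hF, mul_comm]; rfl

theorem ContDiffAt.differentiableAt_pd {f : CoordSpace n → ℝ} {x : CoordSpace n}
    (hf : ContDiffAt ℝ 2 f x) (i : Fin n) : DifferentiableAt ℝ (fun y => pd i f y) x := by
  have : ContDiffAt ℝ 1 (fderiv ℝ f) x := hf.fderiv_right (by norm_num)
  exact (this.differentiableAt (by norm_num)).clm_apply (differentiableAt_const _)

theorem pd_comm {f : CoordSpace n → ℝ} {x : CoordSpace n} (hf : ContDiffAt ℝ 2 f x)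
    (i j : Fin n) : pd i (fun y => pd j f y) x = pd j (fun y => pd i f y) x := by
  have hd : DifferentiableAt ℝ (fderiv ℝ f) x :=
    (hf.fderiv_right (m := 1) (by norm_num)).differentiableAt (by norm_num)
  -- Iterated partials are values of the second Fréchet derivative, whose symmetry then gives the
  -- claim.
  have key : ∀ i j : Fin n, pd i (fun y => pd j f y) x
      = fderiv ℝ (fderiv ℝ f) x (EuclideanSpace.single i 1) (EuclideanSpace.single j 1) := by
    intro i j
    simp only [pd]
    rw [fderiv_clm_apply hd (differentiableAt_const _)]
    simp
  rw [key, key]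
  exact (hf.isSymmSndFDerivAt (by simp)).eq _ _

theorem ContDiffAt.coord {F : CoordSpace n → CoordSpace N} {x : CoordSpace n} {k : WithTop ℕ∞}
    (hF : ContDiffAt ℝ k F x) (a : Fin N) : ContDiffAt ℝ k (fun z => F z a) x :=
  (EuclideanSpace.proj a : CoordSpace N →L[ℝ] ℝ).contDiff.contDiffAt.comp x hF

theorem DifferentiableAt.coord {F : CoordSpace n → CoordSpace N} {x : CoordSpace n}
    (hF : DifferentiableAt ℝ F x) (a : Fin N) : DifferentiableAt ℝ (fun z => F z a) x :=
  (EuclideanSpace.proj a : CoordSpace N →L[ℝ] ℝ).differentiableAt.comp x hF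

end PartialDerivatives

/-! ### Differentiability of determinants and inverse matrices -/

section MatrixInverse

variable {E ι : Type*} [NormedAddCommGroup E] [NormedSpace ℝ E] [Fintype ι] [DecidableEq ι]

theorem differentiableAt_det {A : E → Matrix ι ι ℝ} {x : E}
    (hA : ∀ i j, DifferentiableAt ℝ (fun y => A y i j) x) :
    DifferentiableAt ℝ (fun y => (A y).det) x := by
  simp only [Matrix.det_apply']
  exact DifferentiableAt.fun_sum fun σ _ =>
    (differentiableAt_const _).mul (HasFDerivAt.finsetProd fun i _ =>
      (hA _ _).hasFDerivAt).differentiableAt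

/-- By Cramer's rule, each entry of the inverse is a determinant with one row replaced by a
constant, divided by `det A`. -/
theorem differentiableAt_inv_apply {A : E → Matrix ι ι ℝ} {x : E}
    (hA : ∀ i j, DifferentiableAt ℝ (fun y => A y i j) x) (hx : (A x).det ≠ 0) (i j : ι) :
    DifferentiableAt ℝ (fun y => (A y)⁻¹ i j) x := by
  simp only [Matrix.inv_def, Ring.inverse_eq_inv', Matrix.smul_apply, smul_eq_mul,
    Matrix.adjugate_apply]
  refine ((differentiableAt_det hA).inv hx).mul (differentiableAt_det fun k l => ?_)
  by_cases h : k = j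
  · subst h; simp
  · simpa [Matrix.updateRow_ne h] using hA k l

end MatrixInverse

/-! ### Bilinear forms -/

section Bilinear

variable {n : ℕ}

theorem bilin_eq_dotProduct (A : Matrix (Fin n) (Fin n) ℝ) (X Y : Fin n → ℝ) :
    bilin A X Y = X ⬝ᵥ A.mulVec Y := by
  simp only [bilin, dotProduct, Matrix.mulVec, Finset.mul_sum]
  exact Finset.sum_congr rfl fun i _ => Finset.sum_congr rfl fun j _ => by ring

theorem bilin_comm {A : Matrix (Fin n) (Fin n) ℝ} (hA : ∀ i j, A i j = A j i) (X Y : Fin n → ℝ) :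
    bilin A X Y = bilin A Y X := by
  simp only [bilin]
  rw [Finset.sum_comm]
  exact Finset.sum_congr rfl fun i _ => Finset.sum_congr rfl fun j _ => by rw [hA j i]; ring

theorem bilin_add_left (A : Matrix (Fin n) (Fin n) ℝ) (X Y Z : Fin n → ℝ) :
    bilin A (fun a => X a + Y a) Z = bilin A X Z + bilin A Y Z := by
  simp only [bilin_eq_dotProduct, dotProduct, add_mul, Finset.sum_add_distrib]

theorem bilin_sum_left {ι : Type*} (s : Finset ι) (A : Matrix (Fin n) (Fin n) ℝ) (c : ι → ℝ)
    (X : ι → Fin n → ℝ) (Z : Fin n → ℝ) :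
    bilin A (fun a => ∑ i ∈ s, c i * X i a) Z = ∑ i ∈ s, c i * bilin A (X i) Z := by
  simp only [bilin_eq_dotProduct, dotProduct, Finset.sum_mul, Finset.mul_sum]
  rw [Finset.sum_comm]
  exact Finset.sum_congr rfl fun i _ => Finset.sum_congr rfl fun j _ => by ring

theorem isUnit_det_of_bilin_pos {A : Matrix (Fin n) (Fin n) ℝ}
    (hA : ∀ X : Fin n → ℝ, X ≠ 0 → 0 < bilin A X X) : IsUnit A.det := by
  rw [isUnit_iff_ne_zero]
  intro h
  obtain ⟨v, hv, hv0⟩ := Matrix.exists_mulVec_eq_zero_iff.mpr h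
  have := hA v hv
  simp [bilin_eq_dotProduct, hv0] at this

/-- Expansion of a vector in the frame consisting of a unit timelike normal `N` and vectors `T i`
spanning its orthogonal complement. -/
theorem frame_expansion {A : Matrix (Fin (n + 1)) (Fin (n + 1)) ℝ} (hA : ∀ i j, A i j = A j i)
    {T : Fin n → Fin (n + 1) → ℝ} {ν : Fin (n + 1) → ℝ} (hT : ∀ i, bilin A ν (T i) = 0)
    (hν : bilin A ν ν = -1) {g : Matrix (Fin n) (Fin n) ℝ}
    (hg : ∀ i j, g i j = bilin A (T i) (T j)) (hdet : IsUnit g.det) (W : Fin (n + 1) → ℝ)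
    (a : Fin (n + 1)) :
    W a = -(bilin A W ν) * ν a + ∑ k, (∑ l, g⁻¹ k l * bilin A W (T l)) * T k a := by
  -- The columns of `Q` are the frame `ν, T k`; the rows of `P` are the candidate dual coframe. The
  -- sign in the first row comes from `⟨ν, ν⟩ = -1`.
  let P : Matrix (Unit ⊕ Fin n) (Fin (n + 1)) ℝ := fun p c =>
    Sum.elim (fun _ => -∑ b, A c b * ν b) (fun k => ∑ l, g⁻¹ k l * ∑ b, A c b * T l b) p
  let Q : Matrix (Fin (n + 1)) (Unit ⊕ Fin n) ℝ := fun c p =>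
    Sum.elim (fun _ => ν c) (fun k => T k c) p
  have hb : ∀ X Y : Fin (n + 1) → ℝ, ∑ c, (∑ b, A c b * Y b) * X c = bilin A X Y := by
    intro X Y
    simp only [bilin, Finset.sum_mul]
    exact Finset.sum_congr rfl fun i _ => Finset.sum_congr rfl fun j _ => by ring
  have hb' : ∀ (k : Fin n) (X : Fin (n + 1) → ℝ),
      ∑ c, (∑ l, g⁻¹ k l * ∑ b, A c b * T l b) * X c = ∑ l, g⁻¹ k l * bilin A X (T l) := by
    intro k X
    simp only [← hb, Finset.sum_mul, Finset.mul_sum]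
    rw [Finset.sum_comm]
    exact Finset.sum_congr rfl fun i _ => Finset.sum_congr rfl fun j _ =>
      Finset.sum_congr rfl fun c _ => by ring
  have hPQ : P * Q = 1 := by
    ext p q
    rw [Matrix.mul_apply]
    rcases p with p | p <;> rcases q with q | q
    · simp [P, Q, hb, hν]
    · simp [P, Q, hb, bilin_comm hA (T q), hT]
    · simp [P, Q, hb', hT]
    · simp only [P, Q, Sum.elim_inr, hb']
      have := congrFun (congrFun (Matrix.nonsing_inv_mul g hdet) p) q
      rw [Matrix.mul_apply] at this
      rw [Matrix.one_apply] at this ⊢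
      simp only [Sum.inr.injEq]
      rw [← this]
      exact Finset.sum_congr rfl fun l _ => by rw [hg, bilin_comm hA]
  -- Both index types have `n + 1` elements, so the one-sided inverse is two-sided. This is the
  -- completeness of the frame, and `Q * P` applied to `W` is the expansion.
  have hQP : Q * P = 1 :=
    (Matrix.mul_eq_one_comm_of_card_eq _ _ _ (by simp [add_comm])).mp hPQ
  have h1 : (Q * P).mulVec W a = W a := by rw [hQP, Matrix.one_mulVec]
  rw [← Matrix.mulVec_mulVec] at h1
  rw [← h1]
  simp only [Matrix.mulVec, dotProduct, Fintype.sum_sum_type, Q, P, Sum.elim_inl, Sum.elim_inr,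
    hb', neg_mul, Finset.sum_neg_distrib, hb]
  simp [mul_comm]

end Bilinear

/-! ### Levi-Civita connection in coordinates -/

section LeviCivita

variable {n N : ℕ}

/-- The Christoffel symbols of the first kind, `½ (∂ᵢ gⱼₛ + ∂ⱼ gᵢₛ - ∂ₛ gᵢⱼ)`. -/
def christoffelLower (G : CoordSpace n → Matrix (Fin n) (Fin n) ℝ) (x : CoordSpace n)
    (s i j : Fin n) : ℝ :=
  (pd i (fun y => G y j s) x + pd j (fun y => G y i s) x - pd s (fun y => G y i j) x) / 2

theorem sum_mul_christoffel {G : CoordSpace n → Matrix (Fin n) (Fin n) ℝ} {x : CoordSpace n}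
    (hdet : IsUnit (G x).det) (k i j : Fin n) :
    ∑ l, G x k l * christoffel G x l i j = christoffelLower G x k i j := by
  have h : (G x).mulVec ((G x)⁻¹.mulVec fun s => christoffelLower G x s i j) k
      = christoffelLower G x k i j := by
    rw [Matrix.mulVec_mulVec, Matrix.mul_nonsing_inv _ hdet, Matrix.one_mulVec]
  exact h

theorem sum_mul_gradVec {G : CoordSpace n → Matrix (Fin n) (Fin n) ℝ} {x : CoordSpace n}
    (hdet : IsUnit (G x).det) (f : CoordSpace n → ℝ) (k : Fin n) :
    ∑ l, G x k l * gradVec G f x l = pd k f x := by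
  have h : (G x).mulVec ((G x)⁻¹.mulVec fun s => pd s f x) k = pd k f x := by
    rw [Matrix.mulVec_mulVec, Matrix.mul_nonsing_inv _ hdet, Matrix.one_mulVec]
  exact h

theorem gradInner_eq {G : CoordSpace n → Matrix (Fin n) (Fin n) ℝ} {x : CoordSpace n}
    (hdet : IsUnit (G x).det) (f h : CoordSpace n → ℝ) :
    gradInner G f h x = ∑ i, gradVec G f x i * pd i h x := by
  rw [gradInner, bilin_eq_dotProduct]
  exact Finset.sum_congr rfl fun i _ => congrArg _ (sum_mul_gradVec hdet h i)

theorem gradNorm_eq_sqrt (G : CoordSpace n → Matrix (Fin n) (Fin n) ℝ) (f : CoordSpace n → ℝ)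
    (x : CoordSpace n) : gradNorm G f x = Real.sqrt (gradInner G f f x) := rfl

theorem inv_symm {A : Matrix (Fin n) (Fin n) ℝ} (hA : ∀ i j, A i j = A j i) (i j : Fin n) :
    A⁻¹ i j = A⁻¹ j i := by
  have h : A.transpose = A := by ext i j; exact hA j i
  have := congrFun (congrFun (Matrix.transpose_nonsing_inv A) j) i
  rw [h] at this
  exact this

/-- The Christoffel term of the Hessian, through the gradient. -/
theorem sum_christoffel_mul_pd {G : CoordSpace n → Matrix (Fin n) (Fin n) ℝ} {x : CoordSpace n}
    (hs : ∀ i j, G x i j = G x j i) (f : CoordSpace n → ℝ) (i j : Fin n) :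
    ∑ l, christoffel G x l i j * pd l f x = ∑ s, christoffelLower G x s i j * gradVec G f x s := by
  simp only [christoffel, gradVec, Finset.sum_mul, Finset.mul_sum]
  rw [Finset.sum_comm]
  refine Finset.sum_congr rfl fun s _ => Finset.sum_congr rfl fun l _ => ?_
  rw [inv_symm hs s l, christoffelLower]; ring

theorem differentiableAt_gradVec {G : CoordSpace n → Matrix (Fin n) (Fin n) ℝ}
    {f : CoordSpace n → ℝ} {x : CoordSpace n} (hG : ∀ i j, DifferentiableAt ℝ (fun y => G y i j) x)
    (hdet : IsUnit (G x).det) (hf : ContDiffAt ℝ 2 f x) (l : Fin n) :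
    DifferentiableAt ℝ (fun y => gradVec G f y l) x :=
  DifferentiableAt.fun_sum fun j _ =>
    (differentiableAt_inv_apply hG hdet.ne_zero l j).mul (hf.differentiableAt_pd j)

theorem eventually_isUnit_det {G : CoordSpace n → Matrix (Fin n) (Fin n) ℝ} {x : CoordSpace n}
    (hG : ∀ i j, DifferentiableAt ℝ (fun y => G y i j) x) (hdet : IsUnit (G x).det) :
    ∀ᶠ y in nhds x, IsUnit (G y).det := by
  filter_upwards [(differentiableAt_det hG).continuousAt.eventually_ne hdet.ne_zero] with y hy
  exact isUnit_iff_ne_zero.mpr hy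

/-- Lowering the index in `∇ᵢ ∇ˡ f` gives the Hessian. -/
theorem sum_mul_covDeriv_gradVec {G : CoordSpace n → Matrix (Fin n) (Fin n) ℝ}
    {f : CoordSpace n → ℝ} {x : CoordSpace n} (hG : ∀ i j, DifferentiableAt ℝ (fun y => G y i j) x)
    (hs : ∀ y i j, G y i j = G y j i) (hdet : IsUnit (G x).det) (hf : ContDiffAt ℝ 2 f x)
    (i j : Fin n) :
    ∑ l, G x j l * covDeriv G (gradVec G f) x i l = hessian G f x i j := by
  -- The identity `∂ⱼf = gⱼₗ(∇f)ˡ` holds wherever the metric is invertible, hence near `x`, and can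
  -- be differentiated.
  have h1 : pd i (fun y => pd j f y) x
      = ∑ l, (pd i (fun y => G y j l) x * gradVec G f x l
        + G x j l * pd i (fun y => gradVec G f y l) x) := by
    rw [← pd_congr (f := fun y => ∑ l, G y j l * gradVec G f y l)]
    · rw [pd_sum fun l _ => (hG j l).fun_mul (differentiableAt_gradVec hG hdet hf l)]
      exact Finset.sum_congr rfl fun l _ =>
        pd_mul (hG j l) (differentiableAt_gradVec hG hdet hf l) i
    · filter_upwards [eventually_isUnit_det hG hdet] with y hy
      exact sum_mul_gradVec hy f j
  have h2 : ∑ l, G x j l * ∑ a, christoffel G x l i a * gradVec G f x a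
      = ∑ a, christoffelLower G x j i a * gradVec G f x a := by
    simp only [← sum_mul_christoffel hdet, Finset.sum_mul, Finset.mul_sum]
    rw [Finset.sum_comm]
    exact Finset.sum_congr rfl fun a _ => Finset.sum_congr rfl fun l _ => by ring
  rw [hessian, h1, sum_christoffel_mul_pd (hs x)]
  simp only [covDeriv, mul_add, Finset.sum_add_distrib]
  rw [h2, add_sub_right_comm, add_comm, ← Finset.sum_sub_distrib]
  congr 1
  -- What remains is metric compatibility, `∂ᵢgⱼₐ = Γ_{j,ia} + Γ_{a,ij}` in symbols of the first
  -- kind.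
  refine Finset.sum_congr rfl fun a _ => ?_
  have e1 : pd i (fun y => G y j a) x = pd i (fun y => G y a j) x := by simp only [hs _ j a]
  have e2 : pd a (fun y => G y i j) x = pd a (fun y => G y j i) x := by simp only [hs _ i j]
  simp only [christoffelLower]
  rw [e1, e2]
  ring

theorem levelTrace_add (G : CoordSpace n → Matrix (Fin n) (Fin n) ℝ) (f : CoordSpace n → ℝ)
    (x : CoordSpace n) (A B : Fin n → Fin n → ℝ) :
    levelTrace G f x (fun i j => A i j + B i j) = levelTrace G f x A + levelTrace G f x B := by
  simp only [levelTrace, mul_add, Finset.sum_add_distrib]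

theorem levelTrace_smul (G : CoordSpace n → Matrix (Fin n) (Fin n) ℝ) (f : CoordSpace n → ℝ)
    (x : CoordSpace n) (c : ℝ) (A : Fin n → Fin n → ℝ) :
    levelTrace G f x (fun i j => c * A i j) = c * levelTrace G f x A := by
  simp only [levelTrace, Finset.mul_sum]
  exact Finset.sum_congr rfl fun i _ => Finset.sum_congr rfl fun j _ => by ring

/-- No positivity of the metric is needed: a nonzero square root already has a positive argument. -/
theorem gradNorm_sq {G : CoordSpace n → Matrix (Fin n) (Fin n) ℝ} {f : CoordSpace n → ℝ}
    {x : CoordSpace n} (h : gradNorm G f x ≠ 0) : gradNorm G f x ^ 2 = gradInner G f f x := by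
  rw [gradNorm_eq_sqrt] at h ⊢
  exact Real.sq_sqrt (Real.sqrt_ne_zero'.mp h).le

theorem sum_levelNormal_mul_pd {G : CoordSpace n → Matrix (Fin n) (Fin n) ℝ}
    {f : CoordSpace n → ℝ} {x : CoordSpace n} (hdet : IsUnit (G x).det)
    (h : gradNorm G f x ≠ 0) : ∑ j, levelNormal G f x j * pd j f x = gradNorm G f x := by
  have h1 : ∑ j, levelNormal G f x j * pd j f x = gradInner G f f x / gradNorm G f x := by
    rw [gradInner_eq hdet, Finset.sum_div]
    exact Finset.sum_congr rfl fun j _ => by rw [levelNormal]; ring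
  rw [h1, ← gradNorm_sq h]
  field_simp

/-- The differential `df` vanishes on the level set: the projector `g⁻¹ - ν⊗ν` sends it to `∇f -
|∇f| ν = 0`. -/
theorem levelTrace_mul_pd {G : CoordSpace n → Matrix (Fin n) (Fin n) ℝ}
    {f : CoordSpace n → ℝ} {x : CoordSpace n} (hdet : IsUnit (G x).det)
    (h : gradNorm G f x ≠ 0) (w : Fin n → ℝ) :
    levelTrace G f x (fun i j => w i * pd j f x) = 0 := by
  rw [levelTrace]
  refine Finset.sum_eq_zero fun i _ => ?_
  have : ∑ j, ((G x)⁻¹ i j - levelNormal G f x i * levelNormal G f x j) * (w i * pd j f x)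
      = w i * (gradVec G f x i - levelNormal G f x i * ∑ j, levelNormal G f x j * pd j f x) := by
    rw [gradVec, mul_sub, Finset.mul_sum, Finset.mul_sum, Finset.mul_sum, ← Finset.sum_sub_distrib]
    exact Finset.sum_congr rfl fun j _ => by ring
  rw [this, sum_levelNormal_mul_pd hdet h, levelNormal]
  field_simp
  ring

theorem levelTrace_symm {G : CoordSpace n → Matrix (Fin n) (Fin n) ℝ} {x : CoordSpace n}
    (hs : ∀ i j, G x i j = G x j i) (f : CoordSpace n → ℝ) (A : Fin n → Fin n → ℝ) :
    levelTrace G f x (fun i j => A j i) = levelTrace G f x A := by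
  rw [levelTrace, Finset.sum_comm]
  refine Finset.sum_congr rfl fun i _ => Finset.sum_congr rfl fun j _ => ?_
  rw [inv_symm hs j i]; ring

/-- The full trace of the metric is `n`, and removing the normal direction subtracts `|ν|² = 1`. -/
theorem levelTrace_metric {G : CoordSpace n → Matrix (Fin n) (Fin n) ℝ}
    {f : CoordSpace n → ℝ} {x : CoordSpace n} (hs : ∀ i j, G x i j = G x j i)
    (hdet : IsUnit (G x).det) (h : gradNorm G f x ≠ 0) :
    levelTrace G f x (G x) = n - 1 := by
  have h1 : ∑ i, ∑ j, (G x)⁻¹ i j * G x i j = n := by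
    have : ∀ i, ∑ j, (G x)⁻¹ i j * G x i j = 1 := by
      intro i
      have := congrFun (congrFun (Matrix.nonsing_inv_mul (G x) hdet) i) i
      rw [Matrix.mul_apply, Matrix.one_apply_eq] at this
      rw [← this]
      exact Finset.sum_congr rfl fun j _ => by rw [hs i j]
    simp [this]
  have h2 : ∑ i, ∑ j, levelNormal G f x i * levelNormal G f x j * G x i j = 1 := by
    have : ∀ i, ∑ j, levelNormal G f x i * levelNormal G f x j * G x i j
        = levelNormal G f x i * pd i f x / gradNorm G f x := by
      intro i
      rw [← sum_mul_gradVec hdet f i, Finset.mul_sum, Finset.sum_div]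
      exact Finset.sum_congr rfl fun j _ => by simp only [levelNormal]; ring
    simp only [this]
    rw [← Finset.sum_div, sum_levelNormal_mul_pd hdet h, div_self h]
  simp only [levelTrace, sub_mul, Finset.sum_sub_distrib]
  rw [h1, h2]

/-- `H |∇f| = tr_Σ ∇²f`. -/
theorem levelMeanCurvature_mul_gradNorm {G : CoordSpace n → Matrix (Fin n) (Fin n) ℝ}
    {f : CoordSpace n → ℝ} {x : CoordSpace n} (hG : ∀ i j, DifferentiableAt ℝ (fun y => G y i j) x)
    (hs : ∀ y i j, G y i j = G y j i) (hdet : IsUnit (G x).det) (hf : ContDiffAt ℝ 2 f x)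
    (h : gradNorm G f x ≠ 0) :
    levelMeanCurvature G f x * gradNorm G f x = levelTrace G f x (hessian G f x) := by
  have hgv := differentiableAt_gradVec hG hdet hf
  have hinner : DifferentiableAt ℝ (fun y => gradInner G f f y) x := by
    simp only [gradInner, bilin]
    exact DifferentiableAt.fun_sum fun i _ => DifferentiableAt.fun_sum fun j _ =>
      ((hG i j).mul (hgv i)).mul (hgv j)
  have hnorm : DifferentiableAt ℝ (fun y => gradNorm G f y) x := by
    simp only [gradNorm_eq_sqrt] at h ⊢
    exact hinner.sqrt (Real.sqrt_ne_zero'.mp h).ne'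
  have hinv : DifferentiableAt ℝ (fun y => (gradNorm G f y)⁻¹) x := hnorm.inv h
  -- Differentiating the factor `1/|∇f|` only produces a multiple of `∇f`. Once lowered, this is a
  -- term with factor `df`, which has no trace over the level set.
  have hcov : ∀ i l, covDeriv G (levelNormal G f) x i l * gradNorm G f x
      = covDeriv G (gradVec G f) x i l
        + gradNorm G f x * pd i (fun y => (gradNorm G f y)⁻¹) x * gradVec G f x l := by
    intro i l
    have h1 : pd i (fun y => levelNormal G f y l) x
        = pd i (fun y => gradVec G f y l) x * (gradNorm G f x)⁻¹
          + gradVec G f x l * pd i (fun y => (gradNorm G f y)⁻¹) x := by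
      simp only [levelNormal, div_eq_mul_inv]
      exact pd_mul (hgv l) hinv i
    rw [covDeriv, h1]
    simp only [covDeriv, levelNormal, add_mul, Finset.sum_mul]
    have h2 : ∀ j, christoffel G x l i j * (gradVec G f x j / gradNorm G f x) * gradNorm G f x
        = christoffel G x l i j * gradVec G f x j := fun j => by field_simp
    simp only [h2, mul_assoc, inv_mul_cancel₀ h, mul_one]
    ring
  have hlow : ∀ i j, gradNorm G f x * ∑ l, G x j l * covDeriv G (levelNormal G f) x i l
      = hessian G f x i j
        + gradNorm G f x * pd i (fun y => (gradNorm G f y)⁻¹) x * pd j f x := by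
    intro i j
    rw [← sum_mul_covDeriv_gradVec hG hs hdet hf, ← sum_mul_gradVec hdet f j, Finset.mul_sum,
      Finset.mul_sum, ← Finset.sum_add_distrib]
    refine Finset.sum_congr rfl fun l _ => ?_
    linear_combination G x j l * hcov i l
  rw [levelMeanCurvature, mul_comm, ← levelTrace_smul]
  simp only [hlow]
  rw [levelTrace_add, levelTrace_mul_pd hdet h, add_zero]

end LeviCivita

/-! ### Geometry of a spacelike immersion -/

section Immersion

variable {n N : ℕ}

/-- The coordinate tangent vectors of a parametrisation. -/
def tangentVec (F : CoordSpace n → CoordSpace N) (x : CoordSpace n) (i : Fin n) (a : Fin N) : ℝ :=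
  pd i (fun z => F z a) x

/-- The components of a pulled back metric. -/
def pullbackMetric (G : CoordSpace N → Matrix (Fin N) (Fin N) ℝ) (F : CoordSpace n → CoordSpace N)
    (x : CoordSpace n) : Matrix (Fin n) (Fin n) ℝ := fun i j =>
  bilin (G (F x)) (tangentVec F x i) (tangentVec F x j)

/-- The ambient covariant derivative of `∂ⱼ` along `∂ᵢ`. -/
def derivAlong (G : CoordSpace N → Matrix (Fin N) (Fin N) ℝ) (F : CoordSpace n → CoordSpace N)
    (x : CoordSpace n) (i j : Fin n) (a : Fin N) : ℝ :=
  pd i (fun z => tangentVec F z j a) x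
    + ∑ c, ∑ d, christoffel G (F x) a c d * tangentVec F x i c * tangentVec F x j d

variable {G : CoordSpace N → Matrix (Fin N) (Fin N) ℝ} {F : CoordSpace n → CoordSpace N}
  {x : CoordSpace n}

theorem differentiableAt_tangentVec (hF : ContDiffAt ℝ 2 F x) (i : Fin n) (a : Fin N) :
    DifferentiableAt ℝ (fun z => tangentVec F z i a) x :=
  (hF.coord a).differentiableAt_pd i

theorem differentiableAt_pullbackMetric (hF : ContDiffAt ℝ 2 F x)
    (hG : ∀ a b, DifferentiableAt ℝ (fun y => G y a b) (F x)) (i j : Fin n) :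
    DifferentiableAt ℝ (fun z => pullbackMetric G F z i j) x := by
  simp only [pullbackMetric, bilin]
  exact DifferentiableAt.fun_sum fun a _ => DifferentiableAt.fun_sum fun b _ =>
    (((hG a b).comp x (hF.differentiableAt (by norm_num))).mul
      (differentiableAt_tangentVec hF i a)).mul (differentiableAt_tangentVec hF j b)

theorem pd_pullbackMetric (hF : ContDiffAt ℝ 2 F x)
    (hG : ∀ a b, DifferentiableAt ℝ (fun y => G y a b) (F x)) (k i j : Fin n) :
    pd k (fun z => pullbackMetric G F z i j) x
      = ∑ a, ∑ b, ∑ c, pd c (fun y => G y a b) (F x) * tangentVec F x k c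
          * tangentVec F x i a * tangentVec F x j b
        + bilin (G (F x)) (fun a => pd k (fun z => tangentVec F z i a) x) (tangentVec F x j)
        + bilin (G (F x)) (tangentVec F x i) (fun a => pd k (fun z => tangentVec F z j a) x) := by
  have hFd : DifferentiableAt ℝ F x := hF.differentiableAt (by norm_num)
  have hT := differentiableAt_tangentVec hF
  have hGF : ∀ a b, DifferentiableAt ℝ (fun z => G (F z) a b) x := fun a b => (hG a b).comp x hFd
  simp only [pullbackMetric, bilin]
  rw [pd_sum fun a _ => DifferentiableAt.fun_sum fun b _ =>
      ((hGF a b).fun_mul (hT i a)).fun_mul (hT j b),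
    ← Finset.sum_add_distrib, ← Finset.sum_add_distrib]
  refine Finset.sum_congr rfl fun a _ => ?_
  rw [pd_sum fun b _ => ((hGF a b).fun_mul (hT i a)).fun_mul (hT j b),
    ← Finset.sum_add_distrib, ← Finset.sum_add_distrib]
  refine Finset.sum_congr rfl fun b _ => ?_
  rw [pd_mul ((hGF a b).fun_mul (hT i a)) (hT j b), pd_mul (hGF a b) (hT i a),
    pd_comp (f := fun y => G y a b) (hG a b) hFd, ← Finset.sum_mul, ← Finset.sum_mul]
  simp only [tangentVec]
  ring

theorem sum_rotate {ι : Type*} [Fintype ι] (f : ι → ι → ι → ℝ) :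
    ∑ a, ∑ b, ∑ c, f c a b = ∑ c, ∑ a, ∑ b, f c a b := by
  rw [Finset.sum_comm (s := Finset.univ) (t := Finset.univ) (f := fun c a => ∑ b, f c a b)]
  exact Finset.sum_congr rfl fun a _ => Finset.sum_comm

/-- Pairing with a vector lowers the upper index, so the inverse metric disappears and only first
derivatives of `G` remain. -/
theorem bilin_christoffel (hs : ∀ y a b, G y a b = G y b a) {y : CoordSpace N}
    (hdet : IsUnit (G y).det) (X Y Z : Fin N → ℝ) :
    bilin (G y) (fun a => ∑ c, ∑ d, christoffel G y a c d * X c * Y d) Z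
      = ∑ c, ∑ d, ∑ b, christoffelLower G y b c d * X c * Y d * Z b := by
  have h1 : ∀ c d, bilin (G y) (fun a => christoffel G y a c d) Z
      = ∑ b, christoffelLower G y b c d * Z b := by
    intro c d
    rw [bilin_comm (hs y), bilin_eq_dotProduct]
    refine Finset.sum_congr rfl fun b _ => ?_
    rw [← sum_mul_christoffel hdet, mul_comm]; rfl
  have h2 : ∀ a, ∑ c, ∑ d, christoffel G y a c d * X c * Y d
      = ∑ c, X c * ∑ d, Y d * christoffel G y a c d := fun a => by
    simp only [Finset.mul_sum]
    exact Finset.sum_congr rfl fun c _ => Finset.sum_congr rfl fun d _ => by ring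
  simp only [h2]
  rw [bilin_sum_left _ _ X]
  refine Finset.sum_congr rfl fun c _ => ?_
  rw [bilin_sum_left _ _ Y, Finset.mul_sum]
  refine Finset.sum_congr rfl fun d _ => ?_
  rw [h1, Finset.mul_sum, Finset.mul_sum]
  exact Finset.sum_congr rfl fun b _ => by ring

/-- The Koszul formula for an immersion. -/
theorem christoffelLower_pullbackMetric (hF : ContDiffAt ℝ 2 F x)
    (hG : ∀ a b, DifferentiableAt ℝ (fun y => G y a b) (F x)) (hs : ∀ y a b, G y a b = G y b a)
    (hdet : IsUnit (G (F x)).det) (k i j : Fin n) :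
    christoffelLower (pullbackMetric G F) x k i j
      = bilin (G (F x)) (derivAlong G F x i j) (tangentVec F x k) := by
  -- Equality of mixed partials gives `∂ᵢTⱼ = ∂ⱼTᵢ`. Of the six second-derivative terms in the
  -- Koszul combination, four cancel and two equal copies of `⟨∂ᵢTⱼ, Tₖ⟩` survive. The derivatives
  -- of `G` match after relabelling indices.
  have hcomm : ∀ i j, (fun a => pd i (fun z => tangentVec F z j a) x)
      = fun a => pd j (fun z => tangentVec F z i a) x :=
    fun i j => funext fun a => pd_comm (hF.coord a) i j
  rw [show derivAlong G F x i j = fun a => pd i (fun z => tangentVec F z j a) x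
    + ∑ c, ∑ d, christoffel G (F x) a c d * tangentVec F x i c * tangentVec F x j d from rfl,
    bilin_add_left, bilin_christoffel hs hdet, christoffelLower, pd_pullbackMetric hF hG,
    pd_pullbackMetric hF hG, pd_pullbackMetric hF hG, hcomm j i, hcomm k i, hcomm k j,
    bilin_comm (hs _) (tangentVec F x j), bilin_comm (hs _) (tangentVec F x i)]
  set T := tangentVec F x
  have h1 : ∑ a, ∑ b, ∑ c, pd c (fun y => G y a b) (F x) * T i c * T j a * T k b
      = ∑ c, ∑ d, ∑ b, pd c (fun y => G y d b) (F x) * T i c * T j d * T k b :=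
    sum_rotate fun c a b => pd c (fun y => G y a b) (F x) * T i c * T j a * T k b
  have h2 : ∑ a, ∑ b, ∑ c, pd c (fun y => G y a b) (F x) * T j c * T i a * T k b
      = ∑ c, ∑ d, ∑ b, pd d (fun y => G y c b) (F x) * T i c * T j d * T k b := by
    refine Finset.sum_congr rfl fun a _ => ?_
    rw [Finset.sum_comm]
    exact Finset.sum_congr rfl fun b _ => Finset.sum_congr rfl fun c _ => by ring
  have h3 : ∑ a, ∑ b, ∑ c, pd c (fun y => G y a b) (F x) * T k c * T i a * T j b
      = ∑ c, ∑ d, ∑ b, pd b (fun y => G y c d) (F x) * T i c * T j d * T k b :=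
    Finset.sum_congr rfl fun a _ => Finset.sum_congr rfl fun b _ =>
      Finset.sum_congr rfl fun c _ => by ring
  have h4 : ∑ c, ∑ d, ∑ b, christoffelLower G (F x) b c d * T i c * T j d * T k b
      = (∑ c, ∑ d, ∑ b, pd c (fun y => G y d b) (F x) * T i c * T j d * T k b
        + ∑ c, ∑ d, ∑ b, pd d (fun y => G y c b) (F x) * T i c * T j d * T k b
        - ∑ c, ∑ d, ∑ b, pd b (fun y => G y c d) (F x) * T i c * T j d * T k b) / 2 := by
    simp only [← Finset.sum_add_distrib, ← Finset.sum_sub_distrib, Finset.sum_div]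
    refine Finset.sum_congr rfl fun c _ => Finset.sum_congr rfl fun d _ =>
      Finset.sum_congr rfl fun b _ => ?_
    rw [christoffelLower]; ring
  rw [h1, h2, h3, h4]
  ring

end Immersion

/-! ### Gauss formula, Hessians and gradients on a hypersurface -/

section Hypersurface

variable {n : ℕ} {G : CoordSpace (n + 1) → Matrix (Fin (n + 1)) (Fin (n + 1)) ℝ}
  {F : CoordSpace n → CoordSpace (n + 1)} {x : CoordSpace n} {ν : Fin (n + 1) → ℝ}

/-- The Gauss formula for a spacelike hypersurface with timelike unit normal `ν`. -/
theorem derivAlong_eq (hF : ContDiffAt ℝ 2 F x)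
    (hG : ∀ a b, DifferentiableAt ℝ (fun y => G y a b) (F x)) (hs : ∀ y a b, G y a b = G y b a)
    (hdet : IsUnit (G (F x)).det) (hT : ∀ i, bilin (G (F x)) ν (tangentVec F x i) = 0)
    (hν : bilin (G (F x)) ν ν = -1) (hgdet : IsUnit (pullbackMetric G F x).det)
    (i j : Fin n) (a : Fin (n + 1)) :
    derivAlong G F x i j a = -(bilin (G (F x)) (derivAlong G F x i j) ν) * ν a
      + ∑ l, christoffel (pullbackMetric G F) x l i j * tangentVec F x l a := by
  rw [frame_expansion (hs _) hT hν (fun _ _ => rfl) hgdet (derivAlong G F x i j) a]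
  simp only [← christoffelLower_pullbackMetric hF hG hs hdet]
  rfl

/-- The Hessian of the restriction of `f` to a spacelike hypersurface. -/
theorem hessian_pullbackMetric (hF : ContDiffAt ℝ 2 F x)
    (hG : ∀ a b, DifferentiableAt ℝ (fun y => G y a b) (F x)) (hs : ∀ y a b, G y a b = G y b a)
    (hdet : IsUnit (G (F x)).det) (hT : ∀ i, bilin (G (F x)) ν (tangentVec F x i) = 0)
    (hν : bilin (G (F x)) ν ν = -1) (hgdet : IsUnit (pullbackMetric G F x).det)
    {f : CoordSpace (n + 1) → ℝ} (hf : ContDiffAt ℝ 2 f (F x)) (i j : Fin n) :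
    hessian (pullbackMetric G F) (fun z => f (F z)) x i j
      = bilin (hessian G f (F x)) (tangentVec F x i) (tangentVec F x j)
        - bilin (G (F x)) (derivAlong G F x i j) ν * ∑ a, pd a f (F x) * ν a := by
  have hFd : DifferentiableAt ℝ F x := hF.differentiableAt (by norm_num)
  have hpd : ∀ a, DifferentiableAt ℝ (fun z => pd a f (F z)) x := fun a =>
    (hf.differentiableAt_pd a).comp x hFd
  -- The chain rule is needed on a neighbourhood because its result is differentiated again; `C²` at
  -- a point gives `C¹` nearby.
  have h0 : ∀ j, (fun z => pd j (fun z => f (F z)) z)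
      =ᶠ[nhds x] fun z => ∑ a, pd a f (F z) * tangentVec F z j a := by
    intro j
    filter_upwards [hF.continuousAt.eventually
      ((hf.of_le (by norm_num : (1 : WithTop ℕ∞) ≤ 2)).eventually (by norm_num)),
      (hF.of_le (by norm_num : (1 : WithTop ℕ∞) ≤ 2)).eventually (by norm_num)] with z h1 h2
    exact pd_comp (h1.differentiableAt (by norm_num)) (h2.differentiableAt (by norm_num)) j
  have h1 : pd i (fun z => pd j (fun z => f (F z)) z) x
      = ∑ a, ((∑ b, pd b (fun y => pd a f y) (F x) * tangentVec F x i b) * tangentVec F x j a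
        + pd a f (F x) * pd i (fun z => tangentVec F z j a) x) := by
    rw [pd_congr (h0 j), pd_sum fun a _ => (hpd a).fun_mul (differentiableAt_tangentVec hF j a)]
    refine Finset.sum_congr rfl fun a _ => ?_
    rw [pd_mul (hpd a) (differentiableAt_tangentVec hF j a),
      pd_comp (f := fun y => pd a f y) (hf.differentiableAt_pd a) hFd]
    rfl
  have h2 : ∑ l, christoffel (pullbackMetric G F) x l i j * pd l (fun z => f (F z)) x
      = ∑ a, pd a f (F x) * ∑ l, christoffel (pullbackMetric G F) x l i j * tangentVec F x l a := by
    have : ∀ l, pd l (fun z => f (F z)) x = ∑ a, pd a f (F x) * tangentVec F x l a :=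
      fun l => (h0 l).self_of_nhds
    simp only [this, Finset.mul_sum]
    rw [Finset.sum_comm]
    exact Finset.sum_congr rfl fun a _ => Finset.sum_congr rfl fun l _ => by ring
  have h3 : bilin (hessian G f (F x)) (tangentVec F x i) (tangentVec F x j)
      = ∑ a, ((∑ b, pd b (fun y => pd a f y) (F x) * tangentVec F x i b) * tangentVec F x j a
        - pd a f (F x) * ∑ c, ∑ d,
          christoffel G (F x) a c d * tangentVec F x i c * tangentVec F x j d) := by
    have e1 : ∑ a, pd a f (F x) * ∑ c, ∑ d,
          christoffel G (F x) a c d * tangentVec F x i c * tangentVec F x j d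
        = ∑ c, ∑ d, (∑ a, christoffel G (F x) a c d * pd a f (F x))
          * tangentVec F x i c * tangentVec F x j d := by
      simp only [Finset.mul_sum, Finset.sum_mul]
      rw [sum_rotate fun a c d => christoffel G (F x) a c d * pd a f (F x)
          * tangentVec F x i c * tangentVec F x j d]
      exact Finset.sum_congr rfl fun a _ => Finset.sum_congr rfl fun c _ =>
        Finset.sum_congr rfl fun d _ => by ring
    rw [Finset.sum_sub_distrib, e1]
    simp only [bilin, hessian, sub_mul, Finset.sum_sub_distrib, Finset.sum_mul]
    rw [Finset.sum_comm]
  rw [hessian, h1, h2, h3, Finset.mul_sum, ← Finset.sum_sub_distrib, ← Finset.sum_sub_distrib]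
  refine Finset.sum_congr rfl fun a _ => ?_
  -- All first-derivative terms combine into `df` applied to the Gauss formula, one component at a
  -- time.
  have := derivAlong_eq hF hG hs hdet hT hν hgdet i j a
  simp only [derivAlong] at this ⊢
  linear_combination pd a f (F x) * this

/-- The gradients of two restrictions, through the ambient gradient `U` of `f`. -/
theorem gradInner_pullbackMetric (hFd : DifferentiableAt ℝ F x) (hs : ∀ y a b, G y a b = G y b a)
    (hT : ∀ i, bilin (G (F x)) ν (tangentVec F x i) = 0)
    (hν : bilin (G (F x)) ν ν = -1) (hgdet : IsUnit (pullbackMetric G F x).det)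
    {f h : CoordSpace (n + 1) → ℝ} (hf : DifferentiableAt ℝ f (F x))
    (hh : DifferentiableAt ℝ h (F x)) {U : Fin (n + 1) → ℝ}
    (hU : ∀ b, ∑ a, G (F x) b a * U a = pd b f (F x)) :
    gradInner (pullbackMetric G F) (fun z => f (F z)) (fun z => h (F z)) x
      = ∑ a, U a * pd a h (F x)
        + (∑ a, pd a f (F x) * ν a) * ∑ a, pd a h (F x) * ν a := by
  have hUW : ∀ W, bilin (G (F x)) U W = ∑ a, pd a f (F x) * W a := by
    intro W
    rw [bilin_comm (hs _), bilin_eq_dotProduct]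
    exact Finset.sum_congr rfl fun b _ => by rw [← hU b, mul_comm]; rfl
  -- Since `⟨U, T k⟩ = df(T k)`, the tangential part of `U` is the gradient of the restriction, and
  -- its normal part is `-df(ν) ν`. Applying `dh` gives the formula.
  have hfr := frame_expansion (hs _) hT hν (fun _ _ => rfl) hgdet U
  rw [gradInner_eq hgdet]
  have h1 : ∑ a, U a * pd a h (F x) = ∑ a, (-(bilin (G (F x)) U ν) * ν a
      + ∑ k, gradVec (pullbackMetric G F) (fun z => f (F z)) x k * tangentVec F x k a)
        * pd a h (F x) := by
    refine Finset.sum_congr rfl fun a _ => ?_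
    rw [hfr a]
    simp only [gradVec, hUW, pd_comp hf hFd]
    rfl
  have h2 : ∑ k, gradVec (pullbackMetric G F) (fun z => f (F z)) x k * pd k (fun z => h (F z)) x
      = ∑ a, (∑ k, gradVec (pullbackMetric G F) (fun z => f (F z)) x k * tangentVec F x k a)
        * pd a h (F x) := by
    simp only [pd_comp hh hFd, Finset.sum_mul, Finset.mul_sum]
    rw [Finset.sum_comm]
    refine Finset.sum_congr rfl fun a _ => Finset.sum_congr rfl fun k _ => ?_
    rw [tangentVec]; ring
  rw [h1, h2, hUW, Finset.mul_sum, ← Finset.sum_add_distrib]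
  exact Finset.sum_congr rfl fun a _ => by ring

end Hypersurface

namespace Schwarzschild

/-! ### The Schwarzschild metric in Cartesian coordinates -/

/-- The components of the Euclidean metric of `ℝ³`, pulled back to `ℝ × ℝ³`. -/
def spatial (a b : Fin 4) : ℝ := if a = b ∧ a ≠ 0 then 1 else 0

/-- The function `r* + σ t`; it is `u` for `σ = 1` and `v` for `σ = -1`. -/
def nullFun (m σ : ℝ) (y : CoordSpace 4) : ℝ := tortoise m y + σ * time y

/-- The components of the gradient of `r* + σ t`. -/
def nullGrad (m σ : ℝ) (y : CoordSpace 4) (a : Fin 4) : ℝ :=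
  -(σ * (phiSq m y)⁻¹) * dt a + dr y a

theorem nullU_eq (m : ℝ) : nullU m = nullFun m 1 := by
  funext y; simp [nullU, nullFun]

theorem nullV_eq (m : ℝ) : nullV m = nullFun m (-1) := by
  funext y; simp [nullV, nullFun, sub_eq_add_neg]

theorem metric_symm (m : ℝ) (y : CoordSpace 4) (a b : Fin 4) : metric m y a b = metric m y b a := by
  have h : (a = b ∧ a ≠ 0) ↔ (b = a ∧ b ≠ 0) := by grind
  simp only [metric, sphereMetric, h]
  ring

theorem spatial_symm (a b : Fin 4) : spatial a b = spatial b a := by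
  have h : (a = b ∧ a ≠ 0) ↔ (b = a ∧ b ≠ 0) := by grind
  simp only [spatial, h]

theorem sq_radius (y : CoordSpace 4) : radius y ^ 2 = y 1 ^ 2 + y 2 ^ 2 + y 3 ^ 2 :=
  Real.sq_sqrt (by positivity)

/-- Substituting `r² g_{S²} = δ - dr⊗dr` leaves only `dt`, `dr` and the constant tensor `δ`, the
form used in all later computations. -/
theorem metric_eq {m : ℝ} {y : CoordSpace 4} (hr : 0 < radius y) (a b : Fin 4) :
    metric m y a b = -phiSq m y * (dt a * dt b) + ((phiSq m y)⁻¹ - 1) * (dr y a * dr y b)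
      + spatial a b := by
  rw [metric, sphereMetric, mul_div_cancel₀ _ (pow_ne_zero 2 hr.ne'), spatial]
  ring

theorem sum_dr_mul_dr {y : CoordSpace 4} (hr : 0 < radius y) : ∑ a, dr y a * dr y a = 1 := by
  have h := sq_radius y
  have hd : ∀ i : Fin 3, dr y i.succ = y i.succ / radius y := fun i => by
    simp [dr, Fin.succ_ne_zero]
  have hr2 : radius y ^ 2 ≠ 0 := pow_ne_zero 2 hr.ne'
  have h1 : (y 1 ^ 2 + y 2 ^ 2 + y 3 ^ 2) / radius y ^ 2 = 1 := by rw [← h, div_self hr2]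
  rw [Fin.sum_univ_succ, Fin.sum_univ_three, hd, hd, hd, show dr y 0 = 0 by simp [dr], ← h1]
  change 0 * 0 + (y 1 / radius y * (y 1 / radius y) + y 2 / radius y * (y 2 / radius y)
    + y 3 / radius y * (y 3 / radius y)) = _
  ring

theorem sum_dr_mul_dt (y : CoordSpace 4) : ∑ a, dr y a * dt a = 0 := by
  simp [dr, dt]

theorem sum_dt_mul (X : Fin 4 → ℝ) : ∑ a, dt a * X a = X 0 := by
  simp [dt]

theorem sum_spatial_mul (X : Fin 4 → ℝ) (a : Fin 4) :
    ∑ b, spatial a b * X b = X a - X 0 * dt a := by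
  fin_cases a <;> simp [dt, spatial]

theorem sum_metric_mul {m : ℝ} {y : CoordSpace 4} (hr : 0 < radius y) (X : Fin 4 → ℝ) (a : Fin 4) :
    ∑ b, metric m y a b * X b = -phiSq m y * X 0 * dt a
      + ((phiSq m y)⁻¹ - 1) * (∑ b, dr y b * X b) * dr y a + (X a - X 0 * dt a) := by
  rw [← sum_spatial_mul X a, ← sum_dt_mul X, Finset.mul_sum, Finset.mul_sum, Finset.sum_mul,
    Finset.sum_mul, ← Finset.sum_add_distrib, ← Finset.sum_add_distrib]
  exact Finset.sum_congr rfl fun b _ => by rw [metric_eq hr]; ring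

theorem phiSq_pos {m : ℝ} {y : CoordSpace 4} (hr : 0 < radius y) (hy : 2 * m < radius y) :
    0 < phiSq m y := by
  rw [phiSq, sub_pos, div_lt_one hr]; exact hy

/-- The kernel is trivial: for `X` in it, the time row gives `X 0 = 0`, pairing with `dr` gives `φ⁻²
dr(X) = 0`, and the remaining rows then read `X a = 0`. -/
theorem isUnit_det_metric {m : ℝ} {y : CoordSpace 4} (hr : 0 < radius y) (hy : 2 * m < radius y) :
    IsUnit (metric m y).det := by
  have hφ := phiSq_pos hr hy
  rw [isUnit_iff_ne_zero]
  intro h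
  obtain ⟨X, hX, hX0⟩ := Matrix.exists_mulVec_eq_zero_iff.mpr h
  have hrow : ∀ a, -phiSq m y * X 0 * dt a
      + ((phiSq m y)⁻¹ - 1) * (∑ b, dr y b * X b) * dr y a + (X a - X 0 * dt a) = 0 := by
    intro a
    rw [← sum_metric_mul hr]
    exact congrFun hX0 a
  have h0 : X 0 = 0 := by
    have := hrow 0
    simp [dt, dr, hφ.ne'] at this
    exact this
  simp only [h0] at hrow
  have hD : ∑ b, dr y b * X b = 0 := by
    have h1 : ∑ a, dr y a * (((phiSq m y)⁻¹ - 1) * (∑ b, dr y b * X b) * dr y a + X a) = 0 :=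
      Finset.sum_eq_zero fun a _ => by linear_combination dr y a * hrow a
    have h2 : ∀ c, ∑ a, dr y a * (c * dr y a + X a)
        = c * (∑ a, dr y a * dr y a) + ∑ a, dr y a * X a := by
      intro c
      rw [Finset.mul_sum, ← Finset.sum_add_distrib]
      exact Finset.sum_congr rfl fun a _ => by ring
    rw [h2, sum_dr_mul_dr hr] at h1
    have h3 : (phiSq m y)⁻¹ * ∑ b, dr y b * X b = 0 := by linear_combination h1
    exact (mul_eq_zero.mp h3).resolve_left (inv_ne_zero hφ.ne')
  apply hX
  funext a
  have := hrow a
  rw [hD] at this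
  simpa using this

/-! ### Derivatives -/

theorem contDiffAt_radius {y : CoordSpace 4} (hr : 0 < radius y) {k : WithTop ℕ∞} :
    ContDiffAt ℝ k radius y := by
  have h : y 1 ^ 2 + y 2 ^ 2 + y 3 ^ 2 ≠ 0 := by rw [← sq_radius]; positivity
  have hc : ∀ a : Fin 4, ContDiffAt ℝ k (fun z : CoordSpace 4 => z a) y :=
    fun a => contDiffAt_id.coord a
  exact ((((hc 1).pow 2).add ((hc 2).pow 2)).add ((hc 3).pow 2)).sqrt h

/-- Obtained by differentiating the polynomial identity `r² = x₁² + x₂² + x₃²` and dividing by `2r`.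
-/
theorem pd_radius {y : CoordSpace 4} (hr : 0 < radius y) (c : Fin 4) : pd c radius y = dr y c := by
  have hc : ∀ a : Fin 4, DifferentiableAt ℝ (fun z : CoordSpace 4 => z a) y :=
    fun a => differentiableAt_id.coord a
  have hcc : ∀ a : Fin 4, DifferentiableAt ℝ (fun z : CoordSpace 4 => z a * z a) y :=
    fun a => (hc a).fun_mul (hc a)
  have h1 : pd c (fun z : CoordSpace 4 => z 1 * z 1 + z 2 * z 2 + z 3 * z 3) y
      = 2 * radius y * pd c radius y := by
    have : (fun z : CoordSpace 4 => z 1 * z 1 + z 2 * z 2 + z 3 * z 3)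
        = fun z => radius z * radius z := by
      funext z; rw [← sq (radius z), sq_radius]; ring
    have hd := (contDiffAt_radius hr (k := 1)).differentiableAt (by norm_num)
    rw [this, pd_mul hd hd]; ring
  rw [pd_add ((hcc 1).fun_add (hcc 2)) (hcc 3), pd_add (hcc 1) (hcc 2), pd_mul (hc 1) (hc 1),
    pd_mul (hc 2) (hc 2), pd_mul (hc 3) (hc 3)] at h1
  simp only [pd_coord] at h1
  rw [dr]
  have h2 : pd c radius y = (2 * radius y * pd c radius y) / (2 * radius y) := by field_simp
  rw [h2, ← h1]
  fin_cases c <;> simp <;> field_simp <;> ring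

theorem differentiableAt_radius {y : CoordSpace 4} (hr : 0 < radius y) :
    DifferentiableAt ℝ radius y :=
  (contDiffAt_radius hr (k := 1)).differentiableAt (by norm_num)

theorem differentiableAt_dr {y : CoordSpace 4} (hr : 0 < radius y) (a : Fin 4) :
    DifferentiableAt ℝ (fun z => dr z a) y := by
  by_cases ha : a = 0
  · simp [dr, ha]
  · simp only [dr, ha, if_false, div_eq_mul_inv]
    exact (differentiableAt_id.coord a).mul ((differentiableAt_radius hr).inv hr.ne')

theorem pd_dr {y : CoordSpace 4} (hr : 0 < radius y) (c a : Fin 4) :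
    pd c (fun z => dr z a) y = (spatial c a - dr y c * dr y a) / radius y := by
  by_cases ha : a = 0
  · simp [dr, ha, pd_const, spatial]
  · have hinv : HasDerivAt (fun ρ : ℝ => ρ⁻¹) (-(radius y ^ 2)⁻¹) (radius y) :=
      hasDerivAt_inv hr.ne'
    have h1 : (fun z : CoordSpace 4 => dr z a) = fun z => z a * (radius z)⁻¹ := by
      funext z; simp [dr, ha, div_eq_mul_inv]
    have h2 : spatial c a = if c = a then 1 else 0 := by
      rw [spatial]; congr 1; ext; grind
    rw [h1, pd_mul (f := fun z : CoordSpace 4 => z a) (differentiableAt_id.coord a)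
      ((differentiableAt_radius hr).fun_inv hr.ne'),
      pd_comp_real (f := radius) hinv (differentiableAt_radius hr), pd_radius hr, pd_coord, h2, show dr y a = y a / radius y by simp [dr, ha]]
    field_simp
    ring

theorem hasDerivAt_phiSq {m ρ : ℝ} (hρ : ρ ≠ 0) :
    HasDerivAt (fun ρ : ℝ => 1 - 2 * m / ρ) (2 * m / ρ ^ 2) ρ := by
  have := ((hasDerivAt_inv hρ).const_mul (2 * m)).const_sub 1
  simp only [div_eq_mul_inv]
  exact this.congr_deriv (by ring)

theorem differentiableAt_phiSq {m : ℝ} {y : CoordSpace 4} (hr : 0 < radius y) :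
    DifferentiableAt ℝ (phiSq m) y :=
  (hasDerivAt_phiSq hr.ne').differentiableAt.comp y (differentiableAt_radius hr)

theorem pd_phiSq {m : ℝ} {y : CoordSpace 4} (hr : 0 < radius y) (c : Fin 4) :
    pd c (phiSq m) y = 2 * m / radius y ^ 2 * dr y c := by
  rw [← pd_radius hr]
  exact pd_comp_real (f := radius) (hasDerivAt_phiSq hr.ne') (differentiableAt_radius hr) c

theorem pd_phiSq_inv {m : ℝ} {y : CoordSpace 4} (hr : 0 < radius y) (hy : 2 * m < radius y)
    (c : Fin 4) : pd c (fun z => (phiSq m z)⁻¹) y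
      = -(2 * m / radius y ^ 2 * (phiSq m y)⁻¹ ^ 2) * dr y c := by
  rw [pd_comp_real (hasDerivAt_inv (phiSq_pos hr hy).ne') (differentiableAt_phiSq hr),
    pd_phiSq hr, inv_pow]
  ring

theorem differentiableAt_phiSq_inv {m : ℝ} {y : CoordSpace 4} (hr : 0 < radius y)
    (hy : 2 * m < radius y) : DifferentiableAt ℝ (fun z => (phiSq m z)⁻¹) y :=
  (differentiableAt_phiSq hr).inv (phiSq_pos hr hy).ne'

theorem eventually_exterior {m : ℝ} {y : CoordSpace 4} (hr : 0 < radius y)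
    (hy : 2 * m < radius y) : ∀ᶠ z in nhds y, 0 < radius z ∧ 2 * m < radius z :=
  ((differentiableAt_radius hr).continuousAt.eventually (lt_mem_nhds hr)).and
    ((differentiableAt_radius hr).continuousAt.eventually (lt_mem_nhds hy))

/-- The Cartesian form holds on the open set `r > 0`, so it may replace the metric when
differentiating. It is arranged as sums and products to suit `pd_add` and `pd_mul`. -/
theorem metric_eventuallyEq {m : ℝ} {y : CoordSpace 4} (hr : 0 < radius y)
    (hy : 2 * m < radius y) (a b : Fin 4) :
    (fun z => metric m z a b) =ᶠ[nhds y] fun z => phiSq m z * (-(dt a * dt b))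
      + (((phiSq m z)⁻¹ + (-1)) * (dr z a * dr z b) + spatial a b) := by
  filter_upwards [eventually_exterior hr hy] with z hz
  rw [metric_eq hz.1]; ring

theorem differentiableAt_metric {m : ℝ} {y : CoordSpace 4} (hr : 0 < radius y)
    (hy : 2 * m < radius y) (a b : Fin 4) : DifferentiableAt ℝ (fun z => metric m z a b) y := by
  refine DifferentiableAt.congr_of_eventuallyEq ?_ (metric_eventuallyEq hr hy a b)
  exact ((differentiableAt_phiSq hr).mul_const _).add
    ((((differentiableAt_phiSq_inv hr hy).add_const _).mul
      ((differentiableAt_dr hr a).mul (differentiableAt_dr hr b))).add_const _)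

theorem pd_metric {m : ℝ} {y : CoordSpace 4} (hr : 0 < radius y) (hy : 2 * m < radius y)
    (c a b : Fin 4) : pd c (fun z => metric m z a b) y
      = -(2 * m / radius y ^ 2) * dr y c * (dt a * dt b)
        - 2 * m / radius y ^ 2 * (phiSq m y)⁻¹ ^ 2 * dr y c * (dr y a * dr y b)
        + ((phiSq m y)⁻¹ - 1) / radius y * ((spatial c a - dr y c * dr y a) * dr y b
          + dr y a * (spatial c b - dr y c * dr y b)) := by
  have hφi := differentiableAt_phiSq_inv hr hy
  have hd := differentiableAt_dr hr
  rw [pd_congr (metric_eventuallyEq hr hy a b),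
    pd_add ((differentiableAt_phiSq hr).mul_const _)
      (((hφi.add_const _).fun_mul ((hd a).fun_mul (hd b))).add_const _),
    pd_mul (differentiableAt_phiSq hr) (differentiableAt_const _),
    pd_add ((hφi.add_const _).fun_mul ((hd a).fun_mul (hd b))) (differentiableAt_const _),
    pd_mul (hφi.add_const _) ((hd a).fun_mul (hd b)), pd_add hφi (differentiableAt_const _),
    pd_mul (hd a) (hd b), pd_const, pd_const, pd_const, pd_phiSq hr, pd_phiSq_inv hr hy, pd_dr hr,
    pd_dr hr]
  ring

theorem hasDerivAt_tortoise {m ρ : ℝ} (hm : 0 ≤ m) (hρ : 0 < ρ) (hρm : 2 * m < ρ) :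
    HasDerivAt (fun ρ : ℝ => ρ + 2 * m * Real.log (ρ / (2 * m) - 1)) (1 - 2 * m / ρ)⁻¹ ρ := by
  -- For `m = 0` the logarithm has coefficient zero, so division by `2m = 0` inside it does no harm.
  rcases hm.eq_or_lt with rfl | hm
  · simpa using hasDerivAt_id' ρ
  · have h1 : ρ / (2 * m) - 1 ≠ 0 := by
      have : 1 < ρ / (2 * m) := by rw [one_lt_div (by positivity)]; exact hρm
      linarith
    have h2 : ρ - 2 * m ≠ 0 := by linarith
    refine ((hasDerivAt_id' ρ).add
      (((((hasDerivAt_id' ρ).div_const (2 * m)).sub_const 1).log h1).const_mul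
        (2 * m))).congr_deriv ?_
    field_simp
    ring

theorem contDiffAt_tortoise {m : ℝ} {y : CoordSpace 4} (hm : 0 ≤ m) (hr : 0 < radius y)
    (hy : 2 * m < radius y) {k : WithTop ℕ∞} : ContDiffAt ℝ k (tortoise m) y := by
  rcases hm.eq_or_lt with rfl | hm
  · have : tortoise 0 = radius := by funext z; simp [tortoise]
    rw [this]
    exact contDiffAt_radius hr
  · have h1 : radius y / (2 * m) - 1 ≠ 0 := by
      have : 1 < radius y / (2 * m) := by rw [one_lt_div (by positivity)]; exact hy
      linarith
    exact (contDiffAt_radius hr).add (contDiffAt_const.mul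
      ((((contDiffAt_radius hr).div_const (2 * m)).sub contDiffAt_const).log h1))

theorem contDiffAt_nullFun {m : ℝ} {y : CoordSpace 4} (hm : 0 ≤ m) (hr : 0 < radius y)
    (hy : 2 * m < radius y) (σ : ℝ) {k : WithTop ℕ∞} : ContDiffAt ℝ k (nullFun m σ) y :=
  (contDiffAt_tortoise hm hr hy).add (contDiffAt_const.mul (contDiffAt_id.coord 0))

theorem pd_nullFun {m : ℝ} {y : CoordSpace 4} (hm : 0 ≤ m) (hr : 0 < radius y)
    (hy : 2 * m < radius y) (σ : ℝ) (a : Fin 4) :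
    pd a (nullFun m σ) y = (phiSq m y)⁻¹ * dr y a + σ * dt a := by
  have ht : pd a (tortoise m) y = (phiSq m y)⁻¹ * dr y a := by
    rw [← pd_radius hr]
    exact pd_comp_real (f := radius) (hasDerivAt_tortoise hm hr hy) (differentiableAt_radius hr) a
  have h0 : pd a (fun z => σ * time z) y = σ * dt a := by
    rw [pd_mul (f := fun _ => σ) (h := time) (differentiableAt_const _)
      (differentiableAt_id.coord 0), pd_const]
    have : pd a time y = dt a := pd_coord 0 a y
    rw [this]; ring
  have := pd_add (f := tortoise m) (h := fun z => σ * time z)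
    ((contDiffAt_tortoise hm hr hy (k := 1)).differentiableAt (by norm_num))
    ((differentiableAt_id.coord 0).const_mul σ) a
  rw [ht, h0] at this
  exact this

/-- Lowering the index of the explicit vector identifies it as the gradient without computing the
inverse metric. -/
theorem sum_metric_mul_nullGrad {m : ℝ} {y : CoordSpace 4} (hm : 0 ≤ m) (hr : 0 < radius y)
    (hy : 2 * m < radius y) (σ : ℝ) (b : Fin 4) :
    ∑ a, metric m y b a * nullGrad m σ y a = pd b (nullFun m σ) y := by
  have hφ := (phiSq_pos hr hy).ne'
  have h0 : nullGrad m σ y 0 = -(σ * (phiSq m y)⁻¹) := by simp [nullGrad, dt, dr]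
  have h1 : ∑ b, dr y b * nullGrad m σ y b = 1 := by
    have : ∑ b, dr y b * nullGrad m σ y b = -(σ * (phiSq m y)⁻¹) * ∑ b, dr y b * dt b
        + ∑ b, dr y b * dr y b := by
      rw [Finset.mul_sum, ← Finset.sum_add_distrib]
      exact Finset.sum_congr rfl fun b _ => by rw [nullGrad]; ring
    rw [this, sum_dr_mul_dr hr, sum_dr_mul_dt]; ring
  rw [sum_metric_mul hr, pd_nullFun hm hr hy, h0, h1, nullGrad]
  field_simp
  ring

/-- For `σ = τ = ±1` this says that the gradient is null; for opposite signs it gives `⟨∇̂u, ∇̂v⟩ =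
2/φ²`. -/
theorem sum_nullGrad_mul_pd {m : ℝ} {y : CoordSpace 4} (hm : 0 ≤ m) (hr : 0 < radius y)
    (hy : 2 * m < radius y) (σ τ : ℝ) :
    ∑ a, nullGrad m σ y a * pd a (nullFun m τ) y = (1 - σ * τ) * (phiSq m y)⁻¹ := by
  have h1 : ∑ a, nullGrad m σ y a * pd a (nullFun m τ) y
      = (phiSq m y)⁻¹ * ∑ a, dr y a * dr y a
        + (τ - σ * (phiSq m y)⁻¹ ^ 2) * ∑ a, dr y a * dt a
        - σ * τ * (phiSq m y)⁻¹ * ∑ a, dt a * dt a := by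
    simp only [Finset.mul_sum, ← Finset.sum_add_distrib, ← Finset.sum_sub_distrib]
    exact Finset.sum_congr rfl fun a _ => by rw [pd_nullFun hm hr hy, nullGrad]; ring
  rw [h1, sum_dr_mul_dr hr, sum_dr_mul_dt, sum_dt_mul]
  simp [dt]; ring

theorem gradVec_nullFun {m : ℝ} {y : CoordSpace 4} (hm : 0 ≤ m) (hr : 0 < radius y)
    (hy : 2 * m < radius y) (σ : ℝ) (a : Fin 4) :
    gradVec (metric m) (nullFun m σ) y a = nullGrad m σ y a := by
  have h : (metric m y)⁻¹.mulVec ((metric m y).mulVec (nullGrad m σ y)) a = nullGrad m σ y a := by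
    rw [Matrix.mulVec_mulVec, Matrix.nonsing_inv_mul _ (isUnit_det_metric hr hy),
      Matrix.one_mulVec]
  rw [← h]
  simp only [gradVec, ← sum_metric_mul_nullGrad hm hr hy]
  rfl

/-- The spacetime Hessian of the null functions. -/
theorem hessian_nullFun {m : ℝ} {y : CoordSpace 4} (hm : 0 ≤ m) (hr : 0 < radius y)
    (hy : 2 * m < radius y) {σ : ℝ} (hσ : σ ^ 2 = 1) (a b : Fin 4) :
    hessian (metric m) (nullFun m σ) y a b = metric m y a b / radius y
      - m / radius y ^ 2 * (pd a (nullFun m σ) y * pd b (nullFun m σ) y)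
      - phiSq m y / (2 * radius y) * (pd a (nullFun m 1) y * pd b (nullFun m (-1)) y
        + pd a (nullFun m (-1)) y * pd b (nullFun m 1) y) := by
  have hφ := (phiSq_pos hr hy).ne'
  have hφi := differentiableAt_phiSq_inv hr hy
  have hd := differentiableAt_dr hr
  have h1 : pd a (fun z => pd b (nullFun m σ) z) y
      = -(2 * m / radius y ^ 2 * (phiSq m y)⁻¹ ^ 2) * dr y a * dr y b
        + (phiSq m y)⁻¹ * ((spatial a b - dr y a * dr y b) / radius y) := by
    have : (fun z => pd b (nullFun m σ) z)
        =ᶠ[nhds y] fun z => (phiSq m z)⁻¹ * dr z b + σ * dt b := by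
      filter_upwards [eventually_exterior hr hy] with z hz
      exact pd_nullFun hm hz.1 hz.2 σ b
    rw [pd_congr this, pd_add (hφi.fun_mul (hd b)) (differentiableAt_const _), pd_const,
      pd_mul hφi (hd b), pd_phiSq_inv hr hy, pd_dr hr, add_zero]
  -- The lowered Christoffel symbols are grouped by whether their first index sits on `dt` or on
  -- `dr`, so only `dt` and `dr` of the gradient enter.
  have h2 : ∑ s, christoffelLower (metric m) y s a b * nullGrad m σ y s
      = -(m / radius y ^ 2) * (dr y a * dt b + dr y b * dt a) * ∑ s, dt s * nullGrad m σ y s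
        + (-(m / radius y ^ 2) * (phiSq m y)⁻¹ ^ 2 * (dr y a * dr y b)
          + ((phiSq m y)⁻¹ - 1) / radius y * (spatial a b - dr y a * dr y b)
          + m / radius y ^ 2 * (dt a * dt b)) * ∑ s, dr y s * nullGrad m σ y s := by
    rw [Finset.mul_sum, Finset.mul_sum, ← Finset.sum_add_distrib]
    refine Finset.sum_congr rfl fun s _ => ?_
    rw [christoffelLower, pd_metric hr hy, pd_metric hr hy, pd_metric hr hy, spatial_symm b a,
      spatial_symm s a, spatial_symm s b]
    ring
  have h3 : ∑ s, dr y s * nullGrad m σ y s = 1 := by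
    have : ∑ b, dr y b * nullGrad m σ y b = -(σ * (phiSq m y)⁻¹) * ∑ b, dr y b * dt b
        + ∑ b, dr y b * dr y b := by
      rw [Finset.mul_sum, ← Finset.sum_add_distrib]
      exact Finset.sum_congr rfl fun b _ => by rw [nullGrad]; ring
    rw [this, sum_dr_mul_dr hr, sum_dr_mul_dt]; ring
  have h4 : ∑ s, dt s * nullGrad m σ y s = -(σ * (phiSq m y)⁻¹) := by
    rw [sum_dt_mul]; simp [nullGrad, dt, dr]
  rw [hessian, h1, sum_christoffel_mul_pd (metric_symm m y)]
  simp only [gradVec_nullFun hm hr hy, pd_nullFun hm hr hy]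
  rw [h2, h3, h4, metric_eq hr]
  have hrne := hr.ne'
  have hinv : phiSq m y * (phiSq m y)⁻¹ = 1 := mul_inv_cancel₀ hφ
  linear_combination m / radius y ^ 2 * dt a * dt b * hσ
    + (phiSq m y)⁻¹ / radius y * dr y a * dr y b * hinv

/-- The derivatives of `u` and `v` along a future pointing unit timelike vector have opposite
signs. -/
theorem sum_pd_nullFun_sign {m : ℝ} {y : CoordSpace 4} (hm : 0 ≤ m) (hr : 0 < radius y)
    (hy : 2 * m < radius y) {ν : Fin 4 → ℝ} (hν : bilin (metric m y) ν ν = -1) (h0 : 0 < ν 0) :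
    0 < ∑ a, pd a (nullFun m 1) y * ν a ∧ ∑ a, pd a (nullFun m (-1)) y * ν a < 0 := by
  have hφ := phiSq_pos hr hy
  set D := ∑ a, dr y a * ν a with hD
  have hσ : ∀ σ, ∑ a, pd a (nullFun m σ) y * ν a = (phiSq m y)⁻¹ * D + σ * ν 0 := by
    intro σ
    rw [← sum_dt_mul ν, hD, Finset.mul_sum, Finset.mul_sum, ← Finset.sum_add_distrib]
    exact Finset.sum_congr rfl fun a _ => by rw [pd_nullFun hm hr hy]; ring
  -- Cauchy–Schwarz with `|dr| = 1` in the Euclidean metric.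
  have hCS : D ^ 2 ≤ ν 1 ^ 2 + ν 2 ^ 2 + ν 3 ^ 2 := by
    have h := Finset.sum_mul_sq_le_sq_mul_sq Finset.univ (fun i : Fin 3 => dr y i.succ)
      (fun i => ν i.succ)
    have h1 := sum_dr_mul_dr hr
    have hd0 : dr y 0 = 0 := by simp [dr]
    rw [Fin.sum_univ_succ, hd0] at h1 hD
    simp only [← sq] at h1
    rw [show ∑ i : Fin 3, dr y i.succ ^ 2 = 1 by linarith,
      show ∑ i : Fin 3, dr y i.succ * ν i.succ = D by linarith] at h
    simpa [Fin.sum_univ_three] using h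
  have hN : -phiSq m y * ν 0 ^ 2 + ((phiSq m y)⁻¹ - 1) * D ^ 2
      + (ν 1 ^ 2 + ν 2 ^ 2 + ν 3 ^ 2) = -1 := by
    have h1 : bilin (metric m y) ν ν = ∑ a, ν a * ∑ b, metric m y a b * ν b :=
      bilin_eq_dotProduct _ _ _
    have h2 : ∀ c, ∑ a, ν a * (-phiSq m y * ν 0 * dt a + c * dr y a + (ν a - ν 0 * dt a))
        = (-phiSq m y * ν 0 - ν 0) * (∑ a, dt a * ν a) + c * (∑ a, dr y a * ν a)
          + ∑ a, ν a * ν a := by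
      intro c
      simp only [Finset.mul_sum, ← Finset.sum_add_distrib]
      exact Finset.sum_congr rfl fun a _ => by ring
    have h3 : ∑ a, ν a * ν a = ν 0 ^ 2 + ν 1 ^ 2 + ν 2 ^ 2 + ν 3 ^ 2 := by
      rw [Fin.sum_univ_four]; ring
    simp only [h1, sum_metric_mul hr, h2, sum_dt_mul, ← hD, h3] at hν
    linarith
  -- In the unit condition, the angular part `|ν|² - D²` is nonnegative. Dropping it leaves `φ⁻² D²
  -- < φ² (ν 0)²`, that is, `|dr*(ν)| < dt(ν)`.
  have hlt : ((phiSq m y)⁻¹ * D) ^ 2 < ν 0 ^ 2 := by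
    have h1 : (phiSq m y)⁻¹ * D ^ 2 < phiSq m y * ν 0 ^ 2 := by linarith
    calc ((phiSq m y)⁻¹ * D) ^ 2 = (phiSq m y)⁻¹ * ((phiSq m y)⁻¹ * D ^ 2) := by ring
      _ < (phiSq m y)⁻¹ * (phiSq m y * ν 0 ^ 2) := by gcongr
      _ = ν 0 ^ 2 := by field_simp
  have := abs_lt.mp (abs_lt_of_sq_lt_sq hlt h0.le)
  rw [hσ, hσ]
  constructor <;> linarith [this.1, this.2]

end Schwarzschild

namespace Schwarzschild

/-! ### Slices -/

namespace Slice

variable {m : ℝ} {M : Type*} [TopologicalSpace M] [ChartedSpace (CoordSpace 3) M]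

theorem contDiffAt_param [IsManifold (𝓡 3) ∞ M] (S : Slice m M)
    {e : OpenPartialHomeomorph M (CoordSpace 3)} (he : e ∈ IsManifold.maximalAtlas (𝓡 3) ∞ M)
    {p : M} (hp : p ∈ e.source) : ContDiffAt ℝ ∞ (S.param e) (e p) := by
  rw [← contMDiffAt_iff_contDiffAt]
  exact S.smooth.contMDiffAt.comp (e p) ((contMDiffOn_symm_of_mem_maximalAtlas he).contMDiffAt
    (e.open_target.mem_nhds (e.map_source hp)))

/-- Carries the conditions of `Slice`, stated for intrinsic tangent vectors, over to coordinate
vectors. The witness is the image of `Y` under the differential of `e.symm`, nonzero because the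
differential of `e` inverts it. -/
theorem exists_push_eq [IsManifold (𝓡 3) ∞ M] (S : Slice m M)
    {e : OpenPartialHomeomorph M (CoordSpace 3)} (he : e ∈ IsManifold.maximalAtlas (𝓡 3) ∞ M)
    {p : M} (hp : p ∈ e.source) {Y : CoordSpace 3} (hY : Y ≠ 0) :
    ∃ X : TangentSpace (𝓡 3) p, X ≠ 0 ∧
      push S.toFun p X = fderiv ℝ (S.param e) (e p) Y := by
  have hx : e p ∈ e.target := e.map_source hp
  have hsymm : MDifferentiableAt (𝓡 3) (𝓡 3) e.symm (e p) :=
    ((contMDiffOn_symm_of_mem_maximalAtlas he).contMDiffAt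
      (e.open_target.mem_nhds hx)).mdifferentiableAt (by norm_num)
  have hpe : e.symm (e p) = p := e.left_inv hp
  have he' : MDifferentiableAt (𝓡 3) (𝓡 3) e (e.symm (e p)) := by
    rw [hpe]
    exact ((contMDiffOn_of_mem_maximalAtlas he).contMDiffAt
      (e.open_source.mem_nhds hp)).mdifferentiableAt (by norm_num)
  have hF : MDifferentiableAt (𝓡 3) 𝓘(ℝ, CoordSpace 4) S.toFun (e.symm (e p)) :=
    S.smooth.contMDiffAt.mdifferentiableAt (by norm_num)
  have key : ∃ X : TangentSpace (𝓡 3) (e.symm (e p)), X ≠ 0 ∧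
      push S.toFun (e.symm (e p)) X = fderiv ℝ (S.param e) (e p) Y := by
    refine ⟨mfderiv (𝓡 3) (𝓡 3) e.symm (e p) Y, fun h0 => hY ?_, ?_⟩
    · have h1 := mfderiv_comp (e p) he' hsymm
      have h2 : mfderiv (𝓡 3) (𝓡 3) (e ∘ e.symm) (e p)
          = ContinuousLinearMap.id ℝ (TangentSpace (𝓡 3) (e p)) := by
        rw [← mfderiv_id]
        apply Filter.EventuallyEq.mfderiv_eq
        filter_upwards [e.open_target.mem_nhds hx] with z hz
        exact e.right_inv hz
      have h3 : mfderiv (𝓡 3) (𝓡 3) (e ∘ e.symm) (e p) Y = 0 := by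
        rw [h1]
        exact (congrArg (mfderiv (𝓡 3) (𝓡 3) e (e.symm (e p))) h0).trans (map_zero _)
      rw [h2] at h3
      exact h3
    · rw [push, ← mfderiv_eq_fderiv]
      have h1 := mfderiv_comp (e p) hF hsymm
      exact (DFunLike.congr_fun h1 Y).symm
  rwa [hpe] at key

theorem tangentVec_param_apply [IsManifold (𝓡 3) ∞ M] (S : Slice m M)
    {e : OpenPartialHomeomorph M (CoordSpace 3)} (he : e ∈ IsManifold.maximalAtlas (𝓡 3) ∞ M)
    {p : M} (hp : p ∈ e.source) (Y : CoordSpace 3) (a : Fin 4) :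
    (fderiv ℝ (S.param e) (e p) Y) a = ∑ i, Y i * tangentVec (S.param e) (e p) i a := by
  rw [← fderiv_coord ((S.contDiffAt_param he hp).differentiableAt (by norm_num)),
    fderiv_eq_sum_pd]
  rfl

theorem param_apply (S : Slice m M) {e : OpenPartialHomeomorph M (CoordSpace 3)} {p : M}
    (hp : p ∈ e.source) : S.param e (e p) = S.toFun p := by
  rw [param, e.left_inv hp]

theorem normal_tangentVec [IsManifold (𝓡 3) ∞ M] (S : Slice m M)
    {e : OpenPartialHomeomorph M (CoordSpace 3)} (he : e ∈ IsManifold.maximalAtlas (𝓡 3) ∞ M)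
    {p : M} (hp : p ∈ e.source) (i : Fin 3) :
    bilin (metric m (S.toFun p)) (S.normal p) (tangentVec (S.param e) (e p) i) = 0 := by
  obtain ⟨X, -, hX⟩ := S.exists_push_eq he hp (Y := EuclideanSpace.single i 1) (by simp)
  rw [← S.normal_orthogonal p X, hX]
  congr 1
  funext a
  simp [S.tangentVec_param_apply he hp]

/-- Spacelikeness makes the induced metric positive definite, hence nondegenerate. -/
theorem isUnit_det_inducedMetric [IsManifold (𝓡 3) ∞ M] (S : Slice m M)
    {e : OpenPartialHomeomorph M (CoordSpace 3)} (he : e ∈ IsManifold.maximalAtlas (𝓡 3) ∞ M)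
    {p : M} (hp : p ∈ e.source) : IsUnit (S.inducedMetric e (e p)).det := by
  refine isUnit_det_of_bilin_pos fun Y hY => ?_
  obtain ⟨X, hX0, hX⟩ := S.exists_push_eq he hp (Y := WithLp.toLp 2 Y) (by simpa using hY)
  have h := S.spacelike p X hX0
  have hw : (push S.toFun p X).ofLp = fun a => ∑ i, Y i * tangentVec (S.param e) (e p) i a := by
    funext a
    rw [hX, S.tangentVec_param_apply he hp]
  rw [hw, bilin_sum_left] at h
  refine h.trans_eq ?_
  simp only [bilin_comm (metric_symm m (S.toFun p)) (tangentVec (S.param e) (e p) _)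
    (fun a => ∑ i, Y i * tangentVec (S.param e) (e p) i a), bilin_sum_left, Finset.mul_sum]
  rw [Finset.sum_comm]
  refine Finset.sum_congr rfl fun i _ => Finset.sum_congr rfl fun j _ => ?_
  rw [← S.param_apply hp]
  change _ = bilin (metric m (S.param e (e p))) (tangentVec (S.param e) (e p) i)
    (tangentVec (S.param e) (e p) j) * Y i * Y j
  ring

end Slice

/-! ### The null functions on a spacelike hypersurface -/

section Hypersurface

variable {m : ℝ} {F : CoordSpace 3 → CoordSpace 4} {x : CoordSpace 3} {ν : Fin 4 → ℝ}

theorem gradInner_nullFun (hm : 0 ≤ m) (hr : 0 < radius (F x)) (hy : 2 * m < radius (F x))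
    (hF : DifferentiableAt ℝ F x) (hT : ∀ i, bilin (metric m (F x)) ν (tangentVec F x i) = 0)
    (hν : bilin (metric m (F x)) ν ν = -1)
    (hgdet : IsUnit (pullbackMetric (metric m) F x).det) (σ τ : ℝ) :
    gradInner (pullbackMetric (metric m) F) (fun z => nullFun m σ (F z))
        (fun z => nullFun m τ (F z)) x
      = (1 - σ * τ) * (phiSq m (F x))⁻¹ + (∑ a, pd a (nullFun m σ) (F x) * ν a)
        * ∑ a, pd a (nullFun m τ) (F x) * ν a := by
  have hd : ∀ σ, DifferentiableAt ℝ (nullFun m σ) (F x) := fun σ =>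
    (contDiffAt_nullFun hm hr hy σ (k := 1)).differentiableAt (by norm_num)
  rw [gradInner_pullbackMetric hF (metric_symm m) hT hν hgdet (hd σ) (hd τ)
    (sum_metric_mul_nullGrad hm hr hy σ), sum_nullGrad_mul_pd hm hr hy]

/-- The Hessian of `r* + σ t` on a spacelike hypersurface. -/
theorem hessian_nullFun_comp (hm : 0 ≤ m) (hr : 0 < radius (F x)) (hy : 2 * m < radius (F x))
    (hF : ContDiffAt ℝ 2 F x) (hT : ∀ i, bilin (metric m (F x)) ν (tangentVec F x i) = 0)
    (hν : bilin (metric m (F x)) ν ν = -1)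
    (hgdet : IsUnit (pullbackMetric (metric m) F x).det) {σ : ℝ} (hσ : σ ^ 2 = 1) (i j : Fin 3) :
    hessian (pullbackMetric (metric m) F) (fun z => nullFun m σ (F z)) x i j
      = pullbackMetric (metric m) F x i j / radius (F x)
        - m / radius (F x) ^ 2 * (pd i (fun z => nullFun m σ (F z)) x
          * pd j (fun z => nullFun m σ (F z)) x)
        - phiSq m (F x) / (2 * radius (F x)) * (pd i (fun z => nullFun m 1 (F z)) x
            * pd j (fun z => nullFun m (-1) (F z)) x
          + pd i (fun z => nullFun m (-1) (F z)) x * pd j (fun z => nullFun m 1 (F z)) x)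
        - bilin (metric m (F x)) (derivAlong (metric m) F x i j) ν
          * ∑ a, pd a (nullFun m σ) (F x) * ν a := by
  have hFd : DifferentiableAt ℝ F x := hF.differentiableAt (by norm_num)
  have hpd : ∀ σ i, pd i (fun z => nullFun m σ (F z)) x
      = ∑ a, pd a (nullFun m σ) (F x) * tangentVec F x i a := fun σ i =>
    pd_comp ((contDiffAt_nullFun hm hr hy σ (k := 1)).differentiableAt (by norm_num)) hFd i
  rw [hessian_pullbackMetric hF (differentiableAt_metric hr hy) (metric_symm m)
    (isUnit_det_metric hr hy) hT hν hgdet (contDiffAt_nullFun hm hr hy σ)]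
  congr 1
  have hprod : ∀ σ τ, pd i (fun z => nullFun m σ (F z)) x * pd j (fun z => nullFun m τ (F z)) x
      = ∑ a, ∑ b, pd a (nullFun m σ) (F x) * pd b (nullFun m τ) (F x)
        * tangentVec F x i a * tangentVec F x j b := by
    intro σ τ
    rw [hpd, hpd, Finset.sum_mul_sum]
    exact Finset.sum_congr rfl fun a _ => Finset.sum_congr rfl fun b _ => by ring
  simp only [hprod, pullbackMetric, bilin, hessian_nullFun hm hr hy hσ,
    ← Finset.sum_add_distrib, Finset.mul_sum, Finset.sum_div, ← Finset.sum_sub_distrib]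
  exact Finset.sum_congr rfl fun a _ => Finset.sum_congr rfl fun b _ => by ring

end Hypersurface

/-- A level set of `f` whose Hessian has the form `-κ + c g + df ⊗ w + w ⊗ df` satisfies
`H |∇f| + tr κ = 2 c`. -/
theorem levelMeanCurvature_of_hessian_eq {G : CoordSpace 3 → Matrix (Fin 3) (Fin 3) ℝ}
    {f : CoordSpace 3 → ℝ} {x : CoordSpace 3} (hG : ∀ i j, DifferentiableAt ℝ (fun y => G y i j) x)
    (hs : ∀ y i j, G y i j = G y j i) (hdet : IsUnit (G x).det) (hf : ContDiffAt ℝ 2 f x)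
    (h : gradNorm G f x ≠ 0) {κ : Fin 3 → Fin 3 → ℝ} {b c : ℝ} {w w' : Fin 3 → ℝ}
    (hH : ∀ i j, hessian G f x i j = b * κ i j + c * G x i j + w i * pd j f x + w' j * pd i f x) :
    levelMeanCurvature G f x * gradNorm G f x = b * levelTrace G f x κ + 2 * c := by
  have h1 : hessian G f x
      = fun i j => b * κ i j + c * G x i j + w i * pd j f x + w' j * pd i f x := by
    funext i j; exact hH i j
  -- Both terms with a factor `df` drop out, the second after transposing; the metric contributes `3
  -- - 1 = 2`.
  rw [levelMeanCurvature_mul_gradNorm hG hs hdet hf h, h1, levelTrace_add, levelTrace_add,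
    levelTrace_add, levelTrace_smul, levelTrace_smul G f x c (fun i j => G x i j),
    show levelTrace G f x (fun i j => G x i j) = _ from levelTrace_metric (hs x) hdet h,
    levelTrace_mul_pd hdet h,
    levelTrace_symm (hs x) f (fun i j => w' i * pd j f x), levelTrace_mul_pd hdet h]
  norm_num
  ring

end Schwarzschild

end

/-! ### The null expansions and Hessians of `u` and `v` -/

theorem proposition4p6 (m : ℝ) (hm : 0 ≤ m)
    {M : Type*} [TopologicalSpace M] [ChartedSpace (CoordSpace 3) M] [IsManifold (𝓡 3) ∞ M]
    (S : Schwarzschild.Slice m M)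
    (e : OpenPartialHomeomorph M (CoordSpace 3)) (he : e ∈ IsManifold.maximalAtlas (𝓡 3) ∞ M)
    (p : M) (hp : p ∈ e.source) :
    let x : CoordSpace 3 := e p
    let g := S.inducedMetric e
    let k := S.secondForm e
    let u := S.u e
    let v := S.v e
    let r : ℝ := Schwarzschild.radius (S.toFun p)
    let φsq : ℝ := Schwarzschild.phiSq m (S.toFun p)
    gradNorm g u x ≠ 0 ∧ gradNorm g v x ≠ 0 ∧
    thetaPlus g k u x * gradNorm g u x
      = φsq * (gradNorm g u x * gradNorm g v x + gradInner g u v x) / r ∧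
    thetaMinus g k v x * gradNorm g v x
      = φsq * (gradNorm g u x * gradNorm g v x + gradInner g u v x) / r ∧
    (∀ i j : Fin 3, hessian g u x i j
      = -k x i j * gradNorm g u x
        + g x i j / (2 * r) * φsq * (gradNorm g u x * gradNorm g v x + gradInner g u v x)
        - m / r ^ 2 * (pd i u x * pd j u x)
        - φsq / (2 * r) * (pd i u x * pd j v x + pd i v x * pd j u x)) ∧
    (∀ i j : Fin 3, hessian g v x i j
      = k x i j * gradNorm g v x
        + g x i j / (2 * r) * φsq * (gradNorm g u x * gradNorm g v x + gradInner g u v x)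
        - m / r ^ 2 * (pd i v x * pd j v x)
        - φsq / (2 * r) * (pd i u x * pd j v x + pd i v x * pd j u x)) := by
  intro x g k u v r φsq
  have hxp : S.param e x = S.toFun p := S.param_apply hp
  have hy : 2 * m < Schwarzschild.radius (S.param e x) := by rw [hxp]; exact S.exterior p
  have hr : 0 < Schwarzschild.radius (S.param e x) := by linarith
  have hφ := Schwarzschild.phiSq_pos hr hy
  have hF : ContDiffAt ℝ 2 (S.param e) x := (S.contDiffAt_param he hp).of_le (by norm_cast)
  have hFd : DifferentiableAt ℝ (S.param e) x := hF.differentiableAt (by norm_num)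
  have hT : ∀ i, bilin (Schwarzschild.metric m (S.param e x)) (S.normal p)
      (tangentVec (S.param e) x i) = 0 := by
    rw [hxp]; exact S.normal_tangentVec he hp
  have hν : bilin (Schwarzschild.metric m (S.param e x)) (S.normal p) (S.normal p) = -1 := by
    rw [hxp]; exact S.normal_unit p
  have hdet : IsUnit (g x).det := S.isUnit_det_inducedMetric he hp
  have hgs : ∀ y i j, g y i j = g y j i := fun y i j =>
    bilin_comm (Schwarzschild.metric_symm m _) _ _
  -- The slice's induced metric unfolds to `pullbackMetric` along `S.param e`, so the general
  -- hypersurface lemmas apply directly.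
  have hgd : ∀ i j, DifferentiableAt ℝ (fun y => g y i j) x :=
    differentiableAt_pullbackMetric hF (Schwarzschild.differentiableAt_metric hr hy)
  have hu : u = fun z => Schwarzschild.nullFun m 1 (S.param e z) := by
    funext z; exact congrFun (Schwarzschild.nullU_eq m) _
  have hv : v = fun z => Schwarzschild.nullFun m (-1) (S.param e z) := by
    funext z; exact congrFun (Schwarzschild.nullV_eq m) _
  have hk : ∀ i j, k x i j = bilin (Schwarzschild.metric m (S.param e x))
      (derivAlong (Schwarzschild.metric m) (S.param e) x i j) (S.normal p) := by
    intro i j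
    have : e.symm x = p := e.left_inv hp
    change bilin _ _ (S.normal (e.symm x)) = _
    rw [this]; rfl
  have hf2 : ∀ σ, ContDiffAt ℝ 2 (fun z => Schwarzschild.nullFun m σ (S.param e z)) x :=
    fun σ => (Schwarzschild.contDiffAt_nullFun hm hr hy σ).comp x hF
  have hinner := Schwarzschild.gradInner_nullFun hm hr hy hFd hT hν hdet
  have hhess := fun σ hσ =>
    Schwarzschild.hessian_nullFun_comp hm hr hy hF hT hν hdet (σ := σ) hσ
  obtain ⟨hpos, hneg⟩ := Schwarzschild.sum_pd_nullFun_sign hm hr hy hν (S.normal_future p)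
  set nu := ∑ a, pd a (Schwarzschild.nullFun m 1) (S.param e x) * S.normal p a with hnu
  set nv := ∑ a, pd a (Schwarzschild.nullFun m (-1)) (S.param e x) * S.normal p a with hnv
  have hNu : gradNorm g u x = nu := by
    rw [gradNorm_eq_sqrt, hu, show gradInner g _ _ x = _ from hinner 1 1, ← hnu]
    -- Nullity removes the spacetime term, leaving `|∇u|² = N(u)²`; the sign of `N(u)` selects the
    -- root.
    rw [show (1 - 1 * 1) * (Schwarzschild.phiSq m (S.param e x))⁻¹ + nu * nu = nu ^ 2 by ring]
    exact Real.sqrt_sq hpos.le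
  have hNv : gradNorm g v x = -nv := by
    rw [gradNorm_eq_sqrt, hv, show gradInner g _ _ x = _ from hinner (-1) (-1), ← hnv]
    rw [show (1 - -1 * -1) * (Schwarzschild.phiSq m (S.param e x))⁻¹ + nv * nv = (-nv) ^ 2 by ring]
    exact Real.sqrt_sq (by linarith)
  have hI : gradInner g u v x = 2 * (Schwarzschild.phiSq m (S.param e x))⁻¹ + nu * nv := by
    rw [hu, hv, show gradInner g _ _ x = _ from hinner 1 (-1), ← hnu, ← hnv]
    ring
  have hr' : r = Schwarzschild.radius (S.param e x) := by rw [hxp]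
  have hφ' : φsq = Schwarzschild.phiSq m (S.param e x) := by rw [hxp]
  rw [← hr'] at hr
  rw [← hφ'] at hφ
  -- The products `N(u) N(v)` cancel because `|∇u||∇v| = -N(u) N(v)`.
  have hkey : φsq * (gradNorm g u x * gradNorm g v x + gradInner g u v x) = 2 := by
    rw [hNu, hNv, hI, ← hφ']
    field_simp
    ring
  have hHu : ∀ i j : Fin 3, hessian g u x i j
      = -k x i j * gradNorm g u x + g x i j / r - m / r ^ 2 * (pd i u x * pd j u x)
        - φsq / (2 * r) * (pd i u x * pd j v x + pd i v x * pd j u x) := by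
    intro i j
    rw [hNu, hk, hu, hv, hr', hφ', show hessian g _ x i j = _ from hhess 1 (by norm_num) i j,
      ← hnu, show pullbackMetric (Schwarzschild.metric m) (S.param e) x i j = g x i j from rfl]
    ring
  have hHv : ∀ i j : Fin 3, hessian g v x i j
      = k x i j * gradNorm g v x + g x i j / r - m / r ^ 2 * (pd i v x * pd j v x)
        - φsq / (2 * r) * (pd i u x * pd j v x + pd i v x * pd j u x) := by
    intro i j
    rw [hNv, hk, hu, hv, hr', hφ', show hessian g _ x i j = _ from hhess (-1) (by norm_num) i j,
      ← hnv, show pullbackMetric (Schwarzschild.metric m) (S.param e) x i j = g x i j from rfl]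
    ring
  have hNu0 : gradNorm g u x ≠ 0 := by rw [hNu]; exact hpos.ne'
  have hNv0 : gradNorm g v x ≠ 0 := by rw [hNv]; exact (neg_pos.mpr hneg).ne'
  refine ⟨hNu0, hNv0, ?_, ?_, fun i j => ?_, fun i j => ?_⟩
  · have := Schwarzschild.levelMeanCurvature_of_hessian_eq hgd hgs hdet (hu ▸ hf2 1) hNu0
      (κ := k x) (b := -gradNorm g u x) (c := 1 / r)
      -- Every term other than `k` and `g` contains `du`: `w` collects those with `du` in the second
      -- slot, `w'` the remaining one.
      (w := fun i => -(m / r ^ 2) * pd i u x - φsq / (2 * r) * pd i v x)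
      (w' := fun j => -(φsq / (2 * r)) * pd j v x) fun i j => by rw [hHu]; ring
    rw [thetaPlus, add_mul, this, hkey]
    ring
  · have := Schwarzschild.levelMeanCurvature_of_hessian_eq hgd hgs hdet (hv ▸ hf2 (-1)) hNv0
      (κ := k x) (b := gradNorm g v x) (c := 1 / r)
      (w := fun i => -(m / r ^ 2) * pd i v x - φsq / (2 * r) * pd i u x)
      (w' := fun j => -(φsq / (2 * r)) * pd j u x) fun i j => by rw [hHv]; ring
    rw [thetaMinus, sub_mul, this, hkey]
    ring
  · rw [hHu, mul_assoc _ φsq, hkey]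
    ring
  · rw [hHv, mul_assoc _ φsq, hkey]
    ring
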